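/- **Setting.** Let $\psi:\mathbb{R}^n\to\mathbb{R}\cup\{+\infty\}$ be proper, closed and convex, $Q=\mathrm{dom}\,\psi$, let $f:\mathbb{R}^n\to\mathbb{R}$ be twice continuously differentiable and $F=f+\psi$. Norms are Euclidean for vectors and spectral for matrices. Assume, for some $L\ge 0$ and $\mu>0$, (A1) $\|\nabla^2 f(y)-\nabla^2 f(x)\|\le L\|y-x\|$ for all $x,y\in\mathbb{R}^n$; (A2) $\nabla^2 f(x)\succeq\mu I$ for all $x\in Q$. **Procedure** $\mathtt{CubicSteps}(x,B,\sigma,m,\epsilon)$. Set $x_0=x$ and $t=0$. (1) If $t=m$, return $(x_t,\mathtt{success})$. (2) With $M_{x_t,\sigma}(y)=f(x_t)+\langle\nabla f(x_t),y-x_t\rangle+\frac12\langle B(y-x_t),y-x_t\rangle+\frac{\sigma}{6}\|y-x_t\|^3$, choose any $x_{t+1}$ and $\psi'(x_{t+1})\in\partial\psi(x_{t+1})$ such that $M_{x_t,\sigma}(x_{t+1})+\psi(x_{t+1})\le F(x_t)$ and $\|\nabla M_{x_t,\sigma}(x_{t+1})+\psi'(x_{t+1})\|\le\frac{\sigma}{4}\|x_{t+1}-x_t\|^2$.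 (3) If $\|\nabla f(x_{t+1})+\psi'(x_{t+1})\|\le\epsilon$, return $(x_{t+1},\mathtt{solution})$. (4) If $F(x_0)-F(x_{t+1})\ge\frac{\epsilon^{3/2}}{384\,\sigma^{1/2}}(t+1)$, increase $t$ by one and go to (1); otherwise return $(x_{t+1},\mathtt{halt})$. **First-order (Hessian-free) CNM.** Given $x_0\in Q$, $\tau_0>0$, $\epsilon>0$ and an integer $m\ge1$, for $k=0,1,\dots$ do the following. For $\ell=0,1,2,\dots$ call $\mathtt{CubicSteps}(x_k,B_{k,\ell},\sigma_{k,\ell},m,\epsilon)$ until its status is not $\mathtt{halt}$, where $$\sigma_{k,\ell}=2^4\left(\tfrac23\right)^{1/3}(2^\ell\tau_k)\,m,\qquad h_{k,\ell}=\left[\frac{3\,\sigma_{k,\ell}^{3/2}\epsilon^{3/2}}{2^7\cdot192\,n^{3/2}(2^\ell\tau_k)^3}\right]^{1/3},\qquad B_{k,\ell}=\tfrac12\left(A_{k,\ell}+A_{k,\ell}^\top\right),$$ and the $j$-th column of $A_{k,\ell}$ is $\left(\nabla f(x_k+h_{k,\ell}e_j)-\nabla f(x_k)\right)/h_{k,\ell}$.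 Let $\ell_k$ be the last value of $\ell$ and $x_{k+1}$ the point returned. If the status is $\mathtt{success}$, set $\tau_{k+1}=\max\{\tau_0,2^{\ell_k-1}\tau_k\}$ and continue with $k+1$; if it is $\mathtt{solution}$, stop. For $k\ge1$ let $F'(x_k)=\nabla f(x_k)+\psi'(x_k)$ with the subgradient $\psi'(x_k)$ found by the method, and let $F'(x_0)=\nabla f(x_0)+\psi'(x_0)$ with a given $\psi'(x_0)\in\partial\psi(x_0)$. **Theorem.** Let $c=3^{-1/6}2^{-13/6}$ and $$\kappa=\frac{\mu^2}{2}\left[3\cdot2^6\left(\tfrac23\right)^{1/3}m\max\{\tau_0,L\}+8L+\frac{c^2L^2m}{\tau_0}\right]^{-1}.$$ Assume (A1), (A2) and $\epsilon\le\|F'(x_0)\|\le\kappa/2$. Then every execution of the first-order CNM from $x_0$ reaches, after finitely many iterations, an iterate $x_k$ with $\|\nabla f(x_k)+g\|\le\epsilon$ for some $g\in\partial\psi(x_k)$, and the first such index $T(\epsilon)$ satisfies $$T(\epsilon)\le\frac{1}{\log_2(1+m)}\log_2\log_2\frac{\kappa}{\epsilon}+1.$$ Moreover $$\frac{\|F'(x_k)\|}{\kappa}\le\left(\frac12\right)^{(1+m)^k},\qquad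 0\le k<T(\epsilon),$$ and, if in addition $\|F'(x_0)\|\le\kappa/4$, then $$\frac{\|F'(x_k)\|}{\kappa}\le\left(\frac12\right)^{(1+m)^k+1},\qquad 0\le k<T(\epsilon).$$ -/

import Mathlib

noncomputable section

namespace HFCNM

/-- The space `ℝⁿ` with its standard Euclidean norm. -/
abbrev Vec (n : ℕ) : Type := EuclideanSpace ℝ (Fin n)

variable {n : ℕ}

/-- The effective domain `Q = dom ψ`. -/
def dom (ψ : Vec n → EReal) : Set (Vec n) := {x | ψ x < ⊤}

/-- `ψ : ℝⁿ → ℝ ∪ {+∞}` is proper, closed (lower semicontinuous) and convex. -/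
structure IsProperClosedConvex (ψ : Vec n → EReal) : Prop where
  ne_bot : ∀ x, ψ x ≠ ⊥
  nonempty_dom : (dom ψ).Nonempty
  lsc : LowerSemicontinuous ψ
  convex : ConvexOn ℝ (dom ψ) (fun x => (ψ x).toReal)

/-- The convex subdifferential `∂ψ(x)`, for `x ∈ dom ψ` (empty outside of `dom ψ`). -/
def subdiff (ψ : Vec n → EReal) (x : Vec n) : Set (Vec n) :=
  {p | x ∈ dom ψ ∧ ∀ y, ψ x + ((inner ℝ p (y - x) : ℝ) : EReal) ≤ ψ y}

/-- The Hessian `∇²f(x)`, as a linear operator; its operator norm is the spectral norm. -/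
def hess (f : Vec n → ℝ) (x : Vec n) : Vec n →L[ℝ] Vec n := fderiv ℝ (gradient f) x

/-- The Hessian of `f` is Lipschitz continuous on `ℝⁿ` with constant `L`. -/
def HessianLipschitz (f : Vec n → ℝ) (L : ℝ) : Prop :=
  ∀ x y, ‖hess f y - hess f x‖ ≤ L * ‖y - x‖

/-- `∇²f(x) ⪰ μ I` for all `x ∈ Q`. -/
def HessianBoundedBelow (f : Vec n → ℝ) (Q : Set (Vec n)) (μ : ℝ) : Prop :=
  ∀ x ∈ Q, ∀ v : Vec n, μ * ‖v‖ ^ 2 ≤ inner ℝ (hess f x v) v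

/-- The composite objective `F = f + ψ`. -/
def objective (f : Vec n → ℝ) (ψ : Vec n → EReal) (x : Vec n) : EReal := (f x : EReal) + ψ x

/-- The matrix `A` whose `j`-th column is `(∇f(x + h eⱼ) - ∇f(x)) / h`. -/
def fdMatrix (f : Vec n → ℝ) (x : Vec n) (h : ℝ) : Matrix (Fin n) (Fin n) ℝ :=
  Matrix.of fun i j =>
    (gradient f (x + h • EuclideanSpace.single j (1 : ℝ)) i - gradient f x i) / h

/-- The Hessian approximation `B = (A + Aᵀ) / 2`. -/
def fdHessian (f : Vec n → ℝ) (x : Vec n) (h : ℝ) : Matrix (Fin n) (Fin n) ℝ :=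
  (1 / 2 : ℝ) • (fdMatrix f x h + (fdMatrix f x h).transpose)

/-- The cubic model
`M(y) = f(x) + ⟨∇f(x), y - x⟩ + ½ ⟨B (y - x), y - x⟩ + (σ / 6) ‖y - x‖³`. -/
def model (f : Vec n → ℝ) (B : Matrix (Fin n) (Fin n) ℝ) (σ : ℝ) (x y : Vec n) : ℝ :=
  f x + inner ℝ (gradient f x) (y - x)
    + 1 / 2 * inner ℝ (Matrix.toEuclideanCLM (𝕜 := ℝ) B (y - x)) (y - x)
    + σ / 6 * ‖y - x‖ ^ 3

/-- `x'` is an admissible inexact solution of `min_{y ∈ Q} M(y) + ψ(y)` for the model at `x`,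
and `p' ∈ ∂ψ(x')` is the subgradient that certifies it. -/
def IsInexactStep (f : Vec n → ℝ) (ψ : Vec n → EReal) (B : Matrix (Fin n) (Fin n) ℝ) (σ : ℝ)
    (x x' p' : Vec n) : Prop :=
  p' ∈ subdiff ψ x' ∧
  (model f B σ x x' : EReal) + ψ x' ≤ objective f ψ x ∧
  ‖gradient (model f B σ x) x' + p'‖ ≤ σ / 4 * ‖x' - x‖ ^ 2

/-- The status returned by the procedure `CubicSteps`. -/
inductive Status where
  | success
  | solution
  | halt

/-- The test of sufficient progress `F(x₀) - F(x') ≥ ε^{3/2} / (384 σ^{1/2}) * (t + 1)`. -/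
def SufficientProgress (f : Vec n → ℝ) (ψ : Vec n → EReal) (σ ε : ℝ) (t : ℕ)
    (x₀ x' : Vec n) : Prop :=
  objective f ψ x'
    + ((ε ^ (3 / 2 : ℝ) / (384 * σ ^ (1 / 2 : ℝ)) * ((t : ℝ) + 1) : ℝ) : EReal)
    ≤ objective f ψ x₀

/-- `CubicLoop f ψ B σ m ε x₀ t x p y q α`: the loop of the procedure `CubicSteps` started at
`x₀`, when it enters its first line with counter `t` at the point `x` with the subgradient
`p ∈ ∂ψ(x)`, may return the point `y`, with the subgradient `q ∈ ∂ψ(y)`, and the status `α`.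
The subproblems are solved inexactly, hence a relation and not a function. -/
inductive CubicLoop (f : Vec n → ℝ) (ψ : Vec n → EReal) (B : Matrix (Fin n) (Fin n) ℝ) (σ : ℝ)
    (m : ℕ) (ε : ℝ) (x₀ : Vec n) : ℕ → Vec n → Vec n → Vec n → Vec n → Status → Prop
  | success (x p : Vec n) : CubicLoop f ψ B σ m ε x₀ m x p x p Status.success
  | solution (t : ℕ) (x p x' p' : Vec n) (ht : t ≠ m)
      (hstep : IsInexactStep f ψ B σ x x' p')
      (hsmall : ‖gradient f x' + p'‖ ≤ ε) :
      CubicLoop f ψ B σ m ε x₀ t x p x' p' Status.solution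
  | halt (t : ℕ) (x p x' p' : Vec n) (ht : t ≠ m)
      (hstep : IsInexactStep f ψ B σ x x' p')
      (hlarge : ε < ‖gradient f x' + p'‖)
      (hprog : ¬ SufficientProgress f ψ σ ε t x₀ x') :
      CubicLoop f ψ B σ m ε x₀ t x p x' p' Status.halt
  | next (t : ℕ) (x p x' p' y q : Vec n) (α : Status) (ht : t ≠ m)
      (hstep : IsInexactStep f ψ B σ x x' p')
      (hlarge : ε < ‖gradient f x' + p'‖)
      (hprog : SufficientProgress f ψ σ ε t x₀ x')
      (hrest : CubicLoop f ψ B σ m ε x₀ (t + 1) x' p' y q α) :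
      CubicLoop f ψ B σ m ε x₀ t x p y q α

/-- The procedure `CubicSteps(x, B, σ, m, ε)`, entered with the subgradient `p` of `ψ` at `x`,
may return the point `y`, with the subgradient `q` of `ψ` at `y`, and the status `α`. -/
def CubicSteps (f : Vec n → ℝ) (ψ : Vec n → EReal) (x p : Vec n) (B : Matrix (Fin n) (Fin n) ℝ)
    (σ : ℝ) (m : ℕ) (ε : ℝ) (y q : Vec n) (α : Status) : Prop :=
  CubicLoop f ψ B σ m ε x 0 x p y q α

/-- `σ_{k,ℓ} = 2⁴ (2/3)^{1/3} (2^ℓ τ_k) m`. -/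
def sigmaPar (m : ℕ) (τ : ℝ) (ℓ : ℕ) : ℝ :=
  2 ^ 4 * (2 / 3 : ℝ) ^ (1 / 3 : ℝ) * (2 ^ ℓ * τ) * m

/-- `h_{k,ℓ} = [3 σ_{k,ℓ}^{3/2} ε^{3/2} / (2⁷ ⬝ 192 ⬝ n^{3/2} (2^ℓ τ_k)³)]^{1/3}`. -/
def hPar (n m : ℕ) (ε τ : ℝ) (ℓ : ℕ) : ℝ :=
  (3 * sigmaPar m τ ℓ ^ (3 / 2 : ℝ) * ε ^ (3 / 2 : ℝ) /
    (2 ^ 7 * 192 * (n : ℝ) ^ (3 / 2 : ℝ) * (2 ^ ℓ * τ) ^ 3)) ^ (1 / 3 : ℝ)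

/-- One trial `(k, ℓ)` of the adaptive search of the first-order CNM: the call of `CubicSteps`
from `x_k = x` with `B_{k,ℓ}` and `σ_{k,ℓ}`. -/
def Trial (f : Vec n → ℝ) (ψ : Vec n → EReal) (m : ℕ) (ε : ℝ) (x p : Vec n) (τ : ℝ) (ℓ : ℕ)
    (y q : Vec n) (α : Status) : Prop :=
  CubicSteps f ψ x p (fdHessian f x (hPar n m ε τ ℓ)) (sigmaPar m τ ℓ) m ε y q α

/-- A configuration of the first-order CNM: either it is about to perform the trial `ℓ` of the
iteration `k`, at the iterate `x_k = x` with selected subgradient `p ∈ ∂ψ(x)` and estimate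
`τ_k = τ`, or it has stopped with the last iterate `x_k = x`. -/
inductive Config (n : ℕ) where
  | running (k ℓ : ℕ) (x p : Vec n) (τ : ℝ)
  | stopped (k : ℕ) (x p : Vec n)

/-- In the configuration `c` the current iterate is `x_k = x`, with selected subgradient `p`. -/
def Config.IsIterate (c : Config n) (k : ℕ) (x p : Vec n) : Prop :=
  (∃ (ℓ : ℕ) (τ : ℝ), c = Config.running k ℓ x p τ) ∨ c = Config.stopped k x p

/-- The transitions of the first-order CNM. -/
inductive Step (f : Vec n → ℝ) (ψ : Vec n → EReal) (m : ℕ) (ε τ₀ : ℝ) :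
    Config n → Config n → Prop
  | halt (k ℓ : ℕ) (x p y q : Vec n) (τ : ℝ)
      (h : Trial f ψ m ε x p τ ℓ y q Status.halt) :
      Step f ψ m ε τ₀ (Config.running k ℓ x p τ) (Config.running k (ℓ + 1) x p τ)
  | success (k ℓ : ℕ) (x p y q : Vec n) (τ : ℝ)
      (h : Trial f ψ m ε x p τ ℓ y q Status.success) :
      Step f ψ m ε τ₀ (Config.running k ℓ x p τ)
        (Config.running (k + 1) 0 y q (max τ₀ ((2 : ℝ) ^ ((ℓ : ℤ) - 1) * τ)))
  | solution (k ℓ : ℕ) (x p y q : Vec n) (τ : ℝ)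
      (h : Trial f ψ m ε x p τ ℓ y q Status.solution) :
      Step f ψ m ε τ₀ (Config.running k ℓ x p τ) (Config.stopped (k + 1) y q)

/-- A complete execution of the first-order CNM from `x₀` with selected subgradient
`p₀ ∈ ∂ψ(x₀)`: an infinite sequence of configurations that follows the transitions, and is
constant from the moment when the method stops (if it does). -/
structure IsExecution (f : Vec n → ℝ) (ψ : Vec n → EReal) (m : ℕ) (ε τ₀ : ℝ) (x₀ p₀ : Vec n)
    (c : ℕ → Config n) : Prop where
  init : c 0 = Config.running 0 0 x₀ p₀ τ₀
  step : ∀ i, Step f ψ m ε τ₀ (c i) (c (i + 1)) ∨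
    ((∃ (k : ℕ) (x p : Vec n), c i = Config.stopped k x p) ∧ c (i + 1) = c i)

/-- The set of the iteration indices `k` such that the execution `c` reaches an iterate `x_k`
with `‖∇f(x_k) + q‖ ≤ ε` for some `q ∈ ∂ψ(x_k)`. -/
def solvedIndices (f : Vec n → ℝ) (ψ : Vec n → EReal) (ε : ℝ) (c : ℕ → Config n) : Set ℕ :=
  {k | ∃ (i : ℕ) (x p : Vec n), (c i).IsIterate k x p ∧
    ∃ q ∈ subdiff ψ x, ‖gradient f x + q‖ ≤ ε}

/-- The numerical constant `c = 1 / (3^{1/6} 2^{13/6})`. -/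
def cConst : ℝ := 1 / ((3 : ℝ) ^ (1 / 6 : ℝ) * (2 : ℝ) ^ (13 / 6 : ℝ))

/-- The size `κ` of the region of fast convergence. -/
def kappa (μ L τ₀ : ℝ) (m : ℕ) : ℝ :=
  μ ^ 2 * (1 / 2) *
    (3 * 2 ^ 6 * (2 / 3 : ℝ) ^ (1 / 3 : ℝ) * m * max τ₀ L + 8 * L
      + cConst ^ 2 * L ^ 2 * m / τ₀)⁻¹

end HFCNM

end

namespace HFCNM

variable {n : ℕ}

/-! ### Taylor estimates and strong convexity along segments. -/

section Calculus

variable {f : Vec n → ℝ} {L μ : ℝ}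

/-! All inner steps of an iteration reuse one matrix, computed at the point x_k where the iteration
starts. Its Hessian error at x_t is at most δ + L‖x_t - x_k‖, with δ = (L/2)√n h from finite
differences and the rest from drift. Two facts carry the theorem.

A trial with 2^ℓ τ ≥ L cannot halt (`Trial.lt_of_halt`). A step whose new composite gradient exceeds
ε gains a fixed amount plus a multiple of its cubed length, up to a loss of order L³‖x_t - x_k‖³/σ²
(`step_progress`). By Hölder the cubed drift is at most t² times the sum of the cubed lengths, and σ
≥ 13mL lets the cubic gains of m steps pay for all the losses
(`IsInexactStep.accumulated_progress`). Hence 2^ℓ τ never exceeds 2 max{τ₀, L}.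

In the fast region, strong convexity bounds the step length by the current composite gradient norm
g, and the drift by the initial one g₀, because the progress test keeps x_t in the level set of x_k.
All terms of the new norm g' are then of order g·g₀, except the finite-difference one; AM-GM splits
that into ε/2, absorbed since ε < g', and a quadratic term. The result is g' ≤ g·g₀/κ
(`step_quadratic`), which fixes the form of κ. After m steps g₀/κ has been raised to the power 1 + m
(`CubicLoop.superlinear`).

`Step.invariant` propagates both facts. The bound on 2^ℓ τ excludes endless halting, and the decay
excludes endless success with gradients at least ε, so every execution stops. Two logarithms of the
decay at index T - 1 give the iteration count. -/

theorem differentiable_gradient (hf : ContDiff ℝ 2 f) : Differentiable ℝ (gradient f) := by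
  have h1 : Differentiable ℝ (fderiv ℝ f) :=
    (hf.fderiv_right (m := 1) (by norm_num)).differentiable (by norm_num)
  exact (InnerProductSpace.toDual ℝ (Vec n)).symm.toContinuousLinearEquiv.differentiable.comp h1

theorem hasFDerivAt_gradient (hf : ContDiff ℝ 2 f) (x : Vec n) :
    HasFDerivAt (gradient f) (hess f x) x :=
  (differentiable_gradient hf x).hasFDerivAt

/-- The Hessian of a `C²` function is a symmetric operator. -/
theorem inner_hess_comm (hf : ContDiff ℝ 2 f) (x u v : Vec n) :
    inner ℝ (hess f x u) v = inner ℝ (hess f x v) u := by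
  have h1 : Differentiable ℝ (fderiv ℝ f) :=
    (hf.fderiv_right (m := 1) (by norm_num)).differentiable (by norm_num)
  have key : ∀ u v : Vec n, inner ℝ (hess f x u) v = fderiv ℝ (fderiv ℝ f) x u v := by
    intro u v
    have e1 : HasFDerivAt (fun y => fderiv ℝ f y v)
        ((fderiv ℝ (fderiv ℝ f) x).flip v) x := by
      simpa using (h1 x).hasFDerivAt.clm_apply (hasFDerivAt_const v x)
    have e2 := (hasFDerivAt_gradient hf x).inner ℝ (hasFDerivAt_const v x)
    have e3 : (fun y => fderiv ℝ f y v) = fun y => inner ℝ (gradient f y) v := by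
      funext y; exact inner_gradient_left.symm
    rw [e3] at e1
    have := congrArg (fun T => T u) (e1.unique e2)
    simpa using this.symm
  rw [key, key]
  have hd : ∀ y, HasFDerivAt f (fderiv ℝ f y) y := fun y =>
    (hf.differentiable (by norm_num) y).hasFDerivAt
  exact second_derivative_symmetric hd (h1 x).hasFDerivAt u v

theorem hasDerivAt_line (x d : Vec n) (t : ℝ) : HasDerivAt (fun s : ℝ => x + s • d) d t := by
  simpa using ((hasDerivAt_id t).smul_const d).const_add x

theorem hasDerivAt_gradient_line (hf : ContDiff ℝ 2 f) (x d : Vec n) (t : ℝ) :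
    HasDerivAt (fun s : ℝ => gradient f (x + s • d)) (hess f (x + t • d) d) t :=
  HasFDerivAt.comp_hasDerivAt (f := fun s : ℝ => x + s • d) t
    (hasFDerivAt_gradient hf (x + t • d)) (hasDerivAt_line x d t)

theorem hasDerivAt_line_apply (hf : ContDiff ℝ 2 f) (x d : Vec n) (t : ℝ) :
    HasDerivAt (fun s : ℝ => f (x + s • d)) (inner ℝ (gradient f (x + t • d)) d) t := by
  have h := (hf.differentiable (by norm_num) (x + t • d)).hasFDerivAt.comp_hasDerivAt t
    (hasDerivAt_line x d t)
  rw [inner_gradient_left]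
  exact h

/-- First-order Taylor bound for the gradient along a line. -/
theorem norm_gradient_line_sub_le (hf : ContDiff ℝ 2 f) (hA1 : HessianLipschitz f L)
    (x d : Vec n) {t : ℝ} (ht : t ∈ Set.Icc (0 : ℝ) 1) :
    ‖gradient f (x + t • d) - gradient f x - t • hess f x d‖ ≤ L / 2 * t ^ 2 * ‖d‖ ^ 2 := by
  have hd : ∀ s : ℝ, HasDerivAt (fun s : ℝ => gradient f (x + s • d) - gradient f x
      - s • hess f x d) (hess f (x + s • d) d - hess f x d) s := by
    intro s
    simpa using ((hasDerivAt_gradient_line hf x d s).sub_const (gradient f x)).fun_sub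
      ((hasDerivAt_id s).smul_const (hess f x d))
  refine image_norm_le_of_norm_deriv_right_le_deriv_boundary (a := 0) (b := 1)
    (f := fun s : ℝ => gradient f (x + s • d) - gradient f x - s • hess f x d)
    (B := fun s => L / 2 * s ^ 2 * ‖d‖ ^ 2) (B' := fun s => L * s * ‖d‖ ^ 2)
    (fun s _ => (hd s).continuousAt.continuousWithinAt)
    (fun s _ => (hd s).hasDerivWithinAt) (by simp) ?_ ?_ ht
  · intro s
    refine ((((hasDerivAt_id s).fun_pow 2).const_mul (L / 2)).mul_const (‖d‖ ^ 2)).congr_deriv ?_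
    simp only [id_eq, Nat.cast_ofNat]
    ring
  · intro s hs
    rw [← _root_.sub_apply]
    refine (ContinuousLinearMap.le_opNorm _ _).trans ?_
    have h1 := hA1 x (x + s • d)
    rw [add_sub_cancel_left, norm_smul, Real.norm_of_nonneg hs.1] at h1
    nlinarith [mul_le_mul_of_nonneg_right h1 (norm_nonneg d)]

theorem norm_gradient_sub_le (hf : ContDiff ℝ 2 f) (hA1 : HessianLipschitz f L)
    (x y : Vec n) :
    ‖gradient f y - gradient f x - hess f x (y - x)‖ ≤ L / 2 * ‖y - x‖ ^ 2 := by
  simpa using norm_gradient_line_sub_le hf hA1 x (y - x) (t := 1) (by simp)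

/-- Second-order Taylor upper bound. -/
theorem le_taylor (hf : ContDiff ℝ 2 f) (hA1 : HessianLipschitz f L) (x y : Vec n) :
    f y ≤ f x + inner ℝ (gradient f x) (y - x) + 1 / 2 * inner ℝ (hess f x (y - x)) (y - x)
      + L / 6 * ‖y - x‖ ^ 3 := by
  set d := y - x with hd
  have hB : ∀ s : ℝ, HasDerivAt (fun s : ℝ => f x + s * inner ℝ (gradient f x) d
      + s ^ 2 * (1 / 2 * inner ℝ (hess f x d) d) + s ^ 3 * (L / 6 * ‖d‖ ^ 3))
      (inner ℝ (gradient f x) d + s * inner ℝ (hess f x d) d + s ^ 2 * (L / 2 * ‖d‖ ^ 3)) s := by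
    intro s
    have h := ((((hasDerivAt_id s).mul_const (inner ℝ (gradient f x) d)).const_add (f x)).fun_add
      (((hasDerivAt_id s).fun_pow 2).mul_const (1 / 2 * inner ℝ (hess f x d) d))).fun_add
      (((hasDerivAt_id s).fun_pow 3).mul_const (L / 6 * ‖d‖ ^ 3))
    refine h.congr_deriv ?_
    simp
    ring
  have h := image_le_of_deriv_right_le_deriv_boundary (a := 0) (b := 1)
    (fun s _ => (hasDerivAt_line_apply hf x d s).continuousAt.continuousWithinAt)
    (fun s _ => (hasDerivAt_line_apply hf x d s).hasDerivWithinAt) (by simp)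
    (fun s _ => (hB s).continuousAt.continuousWithinAt)
    (fun s _ => (hB s).hasDerivWithinAt) ?_ (Set.right_mem_Icc.2 zero_le_one)
  · simp only [one_smul, one_mul, one_pow] at h
    rwa [show x + d = y by simp [hd]] at h
  · intro s hs
    have h1 := norm_gradient_line_sub_le hf hA1 x d (Set.Ico_subset_Icc_self hs)
    have h2 := (real_inner_le_norm (gradient f (x + s • d) - gradient f x - s • hess f x d) d).trans
      (mul_le_mul_of_nonneg_right h1 (norm_nonneg d))
    rw [inner_sub_left, inner_sub_left, real_inner_smul_left] at h2
    nlinarith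

/-- Strong convexity on the segments that lie in a set where the Hessian is bounded below. -/
theorem strongly_convex_le (hf : ContDiff ℝ 2 f) {Q : Set (Vec n)} (hQ : Convex ℝ Q)
    (hA2 : HessianBoundedBelow f Q μ) {x y : Vec n} (hx : x ∈ Q) (hy : y ∈ Q) :
    f x + inner ℝ (gradient f x) (y - x) + μ / 2 * ‖y - x‖ ^ 2 ≤ f y := by
  set d := y - x with hd
  -- The Hessian is bounded below only on `Q`, so convexity must keep the whole segment inside; the
  -- bound is then integrated twice.
  have hmem : ∀ s ∈ Set.Ico (0 : ℝ) 1, x + s • d ∈ Q := fun s hs =>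
    hQ.add_smul_sub_mem hx hy (Set.Ico_subset_Icc_self hs)
  have hG : ∀ s : ℝ, HasDerivAt (fun s : ℝ => inner ℝ (gradient f (x + s • d)) d)
      (inner ℝ (hess f (x + s • d) d) d) s := by
    intro s
    simpa using (hasDerivAt_gradient_line hf x d s).inner ℝ (hasDerivAt_const s d)
  have hlin : ∀ s : ℝ, HasDerivAt (fun s : ℝ => inner ℝ (gradient f x) d + s * (μ * ‖d‖ ^ 2))
      (μ * ‖d‖ ^ 2) s := by
    intro s
    simpa using ((hasDerivAt_id s).mul_const (μ * ‖d‖ ^ 2)).const_add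
      (inner ℝ (gradient f x) d)
  have hgrad : ∀ s ∈ Set.Icc (0 : ℝ) 1, inner ℝ (gradient f x) d + s * (μ * ‖d‖ ^ 2)
      ≤ inner ℝ (gradient f (x + s • d)) d := fun s hs =>
    image_le_of_deriv_right_le_deriv_boundary (a := 0) (b := 1)
      (fun s _ => (hlin s).continuousAt.continuousWithinAt)
      (fun s _ => (hlin s).hasDerivWithinAt) (by simp)
      (fun s _ => (hG s).continuousAt.continuousWithinAt)
      (fun s _ => (hG s).hasDerivWithinAt)
      (fun s hs => hA2 _ (hmem s hs) d) hs
  have hquad : ∀ s : ℝ, HasDerivAt (fun s : ℝ => f x + s * inner ℝ (gradient f x) d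
      + s ^ 2 * (μ / 2 * ‖d‖ ^ 2)) (inner ℝ (gradient f x) d + s * (μ * ‖d‖ ^ 2)) s := by
    intro s
    have h := (((hasDerivAt_id s).mul_const (inner ℝ (gradient f x) d)).const_add (f x)).fun_add
      (((hasDerivAt_id s).fun_pow 2).mul_const (μ / 2 * ‖d‖ ^ 2))
    refine h.congr_deriv ?_
    simp
    ring
  have h := image_le_of_deriv_right_le_deriv_boundary (a := 0) (b := 1)
    (fun s _ => (hquad s).continuousAt.continuousWithinAt)
    (fun s _ => (hquad s).hasDerivWithinAt) (by simp)
    (fun s _ => (hasDerivAt_line_apply hf x d s).continuousAt.continuousWithinAt)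
    (fun s _ => (hasDerivAt_line_apply hf x d s).hasDerivWithinAt)
    (fun s hs => hgrad s (Set.Ico_subset_Icc_self hs)) (Set.right_mem_Icc.2 zero_le_one)
  simp only [one_smul, one_mul, one_pow] at h
  rwa [show x + d = y by simp [hd]] at h

end Calculus

/-! ### The cubic model and the finite-difference error. -/

section Model

variable {f : Vec n → ℝ} {L : ℝ}

theorem inner_toEuclideanCLM_comm {B : Matrix (Fin n) (Fin n) ℝ} (hB : B.transpose = B)
    (u v : Vec n) :
    inner ℝ (Matrix.toEuclideanCLM (𝕜 := ℝ) B u) v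
      = inner ℝ (Matrix.toEuclideanCLM (𝕜 := ℝ) B v) u := by
  rw [real_inner_comm, Matrix.inner_toEuclideanCLM, real_inner_comm, Matrix.inner_toEuclideanCLM,
    Matrix.dotProduct_mulVec, ← Matrix.mulVec_transpose, hB, dotProduct_comm]

theorem fdHessian_transpose (f : Vec n → ℝ) (x : Vec n) (h : ℝ) :
    (fdHessian f x h).transpose = fdHessian f x h := by
  simp [fdHessian, add_comm]

/-- The gradient of the cubic model with a symmetric matrix. -/
theorem gradient_model {B : Matrix (Fin n) (Fin n) ℝ} (hB : B.transpose = B) (σ : ℝ)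
    (x y : Vec n) :
    gradient (model f B σ x) y = gradient f x + Matrix.toEuclideanCLM (𝕜 := ℝ) B (y - x)
      + (σ / 2 * ‖y - x‖) • (y - x) := by
  apply HasGradientAt.gradient
  rw [hasGradientAt_iff_hasFDerivAt]
  have hid : HasFDerivAt (fun y : Vec n => y - x) (ContinuousLinearMap.id ℝ (Vec n)) y :=
    (hasFDerivAt_id y).sub_const x
  have h1 := (hasFDerivAt_const (gradient f x) y).inner ℝ hid
  have h2 := (((Matrix.toEuclideanCLM (𝕜 := ℝ) B).hasFDerivAt.comp y hid).inner ℝ hid).const_mul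
    (1 / 2 : ℝ)
  -- As a real power with exponent above 1, the cubed norm is differentiable at the origin too, so y
  -- = x needs no separate case.
  have h3 := ((hasFDerivAt_norm_rpow (y - x) (p := 3) (by norm_num)).comp y hid).const_mul (σ / 6)
  have h := ((h1.const_add (f x)).add h2).add h3
  have e : (fun y => model f B σ x y) = (fun y => f x + inner ℝ (gradient f x) (y - x)
      + 1 / 2 * inner ℝ (Matrix.toEuclideanCLM (𝕜 := ℝ) B (y - x)) (y - x)
      + σ / 6 * ‖y - x‖ ^ (3 : ℝ)) := by
    funext y
    simp only [model]
    norm_cast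
  change HasFDerivAt (fun y => model f B σ x y) _ y
  rw [e]
  refine h.congr_fderiv ?_
  ext v
  have hs := inner_toEuclideanCLM_comm hB v (y - x)
  have hp : ‖y - x‖ ^ ((3 : ℝ) - 2) = ‖y - x‖ := by norm_num
  simp [hp]
  simp [inner_sub_left, inner_sub_right, map_sub] at hs ⊢
  have hc := real_inner_comm (Matrix.toEuclideanCLM (𝕜 := ℝ) B y) v
  have hc' := real_inner_comm (Matrix.toEuclideanCLM (𝕜 := ℝ) B x) v
  linarith

/-- An operator that is bounded by `C` on the standard basis has norm at most `√n C`. -/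
theorem norm_apply_le_of_basis (T : Vec n →L[ℝ] Vec n) {C : ℝ}
    (hT : ∀ j, ‖T (EuclideanSpace.single j 1)‖ ≤ C) (v : Vec n) :
    ‖T v‖ ≤ √n * C * ‖v‖ := by
  have e : T v = ∑ j, v j • T (EuclideanSpace.single j 1) := by
    conv_lhs => rw [← (EuclideanSpace.basisFun (Fin n) ℝ).sum_repr v]
    simp
  -- In dimension zero the hypothesis is vacuous and `C` may be negative.
  rcases Nat.eq_zero_or_pos n with hn | hn
  · subst hn
    simp [e]
  have hC : 0 ≤ C := (norm_nonneg _).trans (hT ⟨0, hn⟩)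
  have h1 : ‖T v‖ ≤ (∑ j, |v j|) * C := by
    rw [e, Finset.sum_mul]
    refine (norm_sum_le _ _).trans (Finset.sum_le_sum fun j _ => ?_)
    rw [norm_smul, Real.norm_eq_abs]
    exact mul_le_mul_of_nonneg_left (hT j) (abs_nonneg _)
  have h2 : ∑ j, |v j| ≤ √n * ‖v‖ := by
    rw [EuclideanSpace.norm_eq, ← Real.sqrt_mul (by positivity)]
    apply Real.le_sqrt_of_sq_le
    simpa using sq_sum_le_card_mul_sum_sq (s := Finset.univ) (f := fun j => |v j|)
  calc ‖T v‖ ≤ (∑ j, |v j|) * C := h1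
    _ ≤ (√n * ‖v‖) * C := mul_le_mul_of_nonneg_right h2 hC
    _ = _ := by ring

theorem fdMatrix_apply_single (f : Vec n → ℝ) (x : Vec n) (h : ℝ) (j : Fin n) :
    Matrix.toEuclideanCLM (𝕜 := ℝ) (fdMatrix f x h) (EuclideanSpace.single j 1)
      = h⁻¹ • (gradient f (x + h • EuclideanSpace.single j (1 : ℝ)) - gradient f x) := by
  ext i
  simp [Matrix.ofLp_toEuclideanCLM, fdMatrix, div_eq_inv_mul]

/-- The error of the forward-difference approximation of the Hessian. -/
theorem norm_fdMatrix_sub_hess_le (hf : ContDiff ℝ 2 f) (hA1 : HessianLipschitz f L)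
    (x : Vec n) {h : ℝ} (hh : 0 < h) (v : Vec n) :
    ‖Matrix.toEuclideanCLM (𝕜 := ℝ) (fdMatrix f x h) v - hess f x v‖
      ≤ L / 2 * (√n * h) * ‖v‖ := by
  have key := norm_apply_le_of_basis
    (Matrix.toEuclideanCLM (𝕜 := ℝ) (fdMatrix f x h) - hess f x) (C := L / 2 * h) ?_ v
  · calc _ ≤ _ := key
      _ = _ := by ring
  intro j
  have h1 := norm_gradient_sub_le hf hA1 x (x + h • EuclideanSpace.single j (1 : ℝ))
  rw [add_sub_cancel_left, norm_smul, Real.norm_of_nonneg hh.le, PiLp.norm_single] at h1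
  simp only [_root_.sub_apply, fdMatrix_apply_single]
  have e : h⁻¹ • (gradient f (x + h • EuclideanSpace.single j (1 : ℝ)) - gradient f x)
      - hess f x (EuclideanSpace.single j 1)
      = h⁻¹ • (gradient f (x + h • EuclideanSpace.single j (1 : ℝ)) - gradient f x
        - hess f x (h • EuclideanSpace.single j 1)) := by
    rw [smul_sub h⁻¹ _ (hess f x _), map_smul, inv_smul_smul₀ hh.ne']
  rw [e, norm_smul, norm_inv, Real.norm_of_nonneg hh.le, inv_mul_le_iff₀ hh]
  calc _ ≤ _ := h1
    _ = _ := by simp; ring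

/-- The error of the symmetrized forward-difference approximation of the Hessian. -/
theorem norm_fdHessian_sub_hess_le (hf : ContDiff ℝ 2 f) (hL : 0 ≤ L)
    (hA1 : HessianLipschitz f L) (x : Vec n) {h : ℝ} (hh : 0 < h) (v : Vec n) :
    ‖Matrix.toEuclideanCLM (𝕜 := ℝ) (fdHessian f x h) v - hess f x v‖
      ≤ L / 2 * (√n * h) * ‖v‖ := by
  set T := Matrix.toEuclideanCLM (𝕜 := ℝ) (fdMatrix f x h) - hess f x with hTdef
  have hC : 0 ≤ L / 2 * (√n * h) := by positivity
  have hT : ‖T‖ ≤ L / 2 * (√n * h) :=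
    T.opNorm_le_bound hC (norm_fdMatrix_sub_hess_le hf hA1 x hh)
  have hadj : ContinuousLinearMap.adjoint (hess f x) = hess f x := by
    rw [eq_comm, ContinuousLinearMap.eq_adjoint_iff]
    intro u w
    rw [inner_hess_comm hf, real_inner_comm]
  have htr : Matrix.toEuclideanCLM (𝕜 := ℝ) (fdMatrix f x h).transpose
      = ContinuousLinearMap.adjoint (Matrix.toEuclideanCLM (𝕜 := ℝ) (fdMatrix f x h)) := by
    rw [← ContinuousLinearMap.star_eq_adjoint, ← map_star, Matrix.star_eq_conjTranspose,
      Matrix.conjTranspose_eq_transpose_of_trivial]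
  -- Since the Hessian is self-adjoint, symmetrizing the matrix averages the error with its adjoint,
  -- which has the same norm; nothing is lost.
  have e : Matrix.toEuclideanCLM (𝕜 := ℝ) (fdHessian f x h) - hess f x
      = (1 / 2 : ℝ) • (T + ContinuousLinearMap.adjoint T) := by
    rw [fdHessian, map_smul, map_add, htr, hTdef, map_sub, hadj]
    module
  rw [← _root_.sub_apply]
  refine (ContinuousLinearMap.le_opNorm _ _).trans
    (mul_le_mul_of_nonneg_right ?_ (norm_nonneg v))
  rw [e, norm_smul]
  have h1 := norm_add_le T (ContinuousLinearMap.adjoint T)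
  rw [LinearIsometryEquiv.norm_map] at h1
  norm_num
  linarith

end Model

end HFCNM

namespace HFCNM

variable {n : ℕ}

/-! ### One inexact step with a Hessian approximation from an earlier point. -/

section Step

variable {f : Vec n → ℝ} {ψ : Vec n → EReal} {L μ σ δ : ℝ}

/-- The value of `F = f + ψ` as a real number, meaningful on `dom ψ`. -/
def realObjective (f : Vec n → ℝ) (ψ : Vec n → EReal) (x : Vec n) : ℝ := f x + (ψ x).toReal

theorem coe_toReal_of_mem_dom (hψ : IsProperClosedConvex ψ) {x : Vec n} (hx : x ∈ dom ψ) :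
    (((ψ x).toReal : ℝ) : EReal) = ψ x :=
  EReal.coe_toReal (ne_of_lt hx) (hψ.ne_bot x)

theorem objective_eq_coe (hψ : IsProperClosedConvex ψ) {x : Vec n} (hx : x ∈ dom ψ) :
    objective f ψ x = (realObjective f ψ x : ℝ) := by
  rw [objective, realObjective, EReal.coe_add, coe_toReal_of_mem_dom hψ hx]

theorem sufficientProgress_iff (hψ : IsProperClosedConvex ψ) {σ ε : ℝ} {t : ℕ} {x y : Vec n}
    (hx : x ∈ dom ψ) (hy : y ∈ dom ψ) :
    SufficientProgress f ψ σ ε t x y ↔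
      realObjective f ψ y + ε ^ (3 / 2 : ℝ) / (384 * σ ^ (1 / 2 : ℝ)) * ((t : ℝ) + 1)
        ≤ realObjective f ψ x := by
  rw [SufficientProgress, objective_eq_coe hψ hx, objective_eq_coe hψ hy, ← EReal.coe_add,
    EReal.coe_le_coe_iff]

theorem subgradient_le (hψ : IsProperClosedConvex ψ) {x y p : Vec n} (hp : p ∈ subdiff ψ x)
    (hy : y ∈ dom ψ) : (ψ x).toReal + inner ℝ p (y - x) ≤ (ψ y).toReal := by
  have h := hp.2 y
  rw [← coe_toReal_of_mem_dom hψ hp.1, ← coe_toReal_of_mem_dom hψ hy, ← EReal.coe_add,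
    EReal.coe_le_coe_iff] at h
  exact h

/-- Points of the level set of `x` stay close to `x` when the composite gradient is small. -/
theorem norm_sub_le_of_realObjective_le (hf : ContDiff ℝ 2 f) (hψ : IsProperClosedConvex ψ)
    (hμ : 0 < μ) (hA2 : HessianBoundedBelow f (dom ψ) μ) {x y p : Vec n}
    (hp : p ∈ subdiff ψ x) (hy : y ∈ dom ψ)
    (hle : realObjective f ψ y ≤ realObjective f ψ x) :
    ‖y - x‖ ≤ 2 * ‖gradient f x + p‖ / μ := by
  have h1 := strongly_convex_le hf hψ.convex.1 hA2 hp.1 hy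
  have h2 := subgradient_le hψ hp hy
  have h3 := neg_le_of_abs_le (abs_real_inner_le_norm (gradient f x + p) (y - x))
  rw [inner_add_left] at h3
  unfold realObjective at hle
  rw [le_div_iff₀ hμ]
  have h4 : μ / 2 * ‖y - x‖ ^ 2 ≤ ‖gradient f x + p‖ * ‖y - x‖ := by linarith
  rcases (norm_nonneg (y - x)).eq_or_lt with h0 | h0
  · rw [← h0]; simp
  · have := le_of_mul_le_mul_right (a := ‖y - x‖) (b := μ / 2 * ‖y - x‖)
      (c := ‖gradient f x + p‖) (by linarith [h4]) h0
    linarith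

variable {B : Matrix (Fin n) (Fin n) ℝ} {x₀ x x' p p' : Vec n}

/-- The price of reusing at `x` a matrix built at `x₀`: the drift times `L` is added to the initial
error. -/
theorem norm_sub_hess_le (hA1 : HessianLipschitz f L)
    (hB : ∀ v, ‖Matrix.toEuclideanCLM (𝕜 := ℝ) B v - hess f x₀ v‖ ≤ δ * ‖v‖) (x v : Vec n) :
    ‖Matrix.toEuclideanCLM (𝕜 := ℝ) B v - hess f x v‖ ≤ (δ + L * ‖x - x₀‖) * ‖v‖ := by
  have h1 : ‖hess f x v - hess f x₀ v‖ ≤ L * ‖x - x₀‖ * ‖v‖ := by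
    rw [← _root_.sub_apply]
    exact (ContinuousLinearMap.le_opNorm _ _).trans
      (mul_le_mul_of_nonneg_right (hA1 x₀ x) (norm_nonneg v))
  have h2 := norm_sub_le (Matrix.toEuclideanCLM (𝕜 := ℝ) B v - hess f x₀ v)
    (hess f x v - hess f x₀ v)
  rw [sub_sub_sub_cancel_right] at h2
  linarith [hB v]

theorem IsInexactStep.model_add_le (hψ : IsProperClosedConvex ψ) (hx : x ∈ dom ψ)
    (h : IsInexactStep f ψ B σ x x' p') :
    model f B σ x x' + (ψ x').toReal ≤ realObjective f ψ x := by
  have h1 := h.2.1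
  rw [objective_eq_coe hψ hx, ← coe_toReal_of_mem_dom hψ h.1.1, ← EReal.coe_add,
    EReal.coe_le_coe_iff] at h1
  exact h1

/-- The composite gradient after one inexact step. -/
theorem IsInexactStep.norm_gradient_le (hf : ContDiff ℝ 2 f) (hA1 : HessianLipschitz f L)
    (hσ : 0 ≤ σ) (hBt : B.transpose = B)
    (hB : ∀ v, ‖Matrix.toEuclideanCLM (𝕜 := ℝ) B v - hess f x₀ v‖ ≤ δ * ‖v‖)
    (h : IsInexactStep f ψ B σ x x' p') :
    ‖gradient f x' + p'‖ ≤ (L / 2 + 3 * σ / 4) * ‖x' - x‖ ^ 2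
      + (δ + L * ‖x - x₀‖) * ‖x' - x‖ := by
  have h1 := norm_gradient_sub_le hf hA1 x x'
  have h2 := norm_sub_hess_le hA1 hB x (x' - x)
  have h3 := h.2.2
  rw [gradient_model hBt] at h3
  set d := x' - x
  set Bd := Matrix.toEuclideanCLM (𝕜 := ℝ) B d
  have h4 : ‖(σ / 2 * ‖d‖) • d‖ = σ / 2 * ‖d‖ ^ 2 := by
    rw [norm_smul, Real.norm_of_nonneg (by positivity)]; ring
  -- Taylor remainder, Hessian error, cubic term and inexactness residual. The last two contribute
  -- σ/2 + σ/4 = 3σ/4.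
  have e : gradient f x' + p' = (gradient f x' - gradient f x - hess f x d)
      + (-(Bd - hess f x d) + (-((σ / 2 * ‖d‖) • d)
      + (gradient f x + Bd + (σ / 2 * ‖d‖) • d + p'))) := by abel
  rw [e]
  refine (norm_add_le _ _).trans ?_
  have i1 := norm_add_le (-(Bd - hess f x d)) (-((σ / 2 * ‖d‖) • d)
      + (gradient f x + Bd + (σ / 2 * ‖d‖) • d + p'))
  have i2 := norm_add_le (-((σ / 2 * ‖d‖) • d)) (gradient f x + Bd + (σ / 2 * ‖d‖) • d + p')
  rw [norm_neg] at i1 i2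
  linarith

/-- The decrease of the objective in one inexact step. -/
theorem IsInexactStep.realObjective_le (hf : ContDiff ℝ 2 f) (hψ : IsProperClosedConvex ψ)
    (hA1 : HessianLipschitz f L)
    (hB : ∀ v, ‖Matrix.toEuclideanCLM (𝕜 := ℝ) B v - hess f x₀ v‖ ≤ δ * ‖v‖)
    (hx : x ∈ dom ψ) (h : IsInexactStep f ψ B σ x x' p') :
    realObjective f ψ x' ≤ realObjective f ψ x + (δ + L * ‖x - x₀‖) * ‖x' - x‖ ^ 2 / 2
      - (σ - L) / 6 * ‖x' - x‖ ^ 3 := by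
  have h1 := le_taylor hf hA1 x x'
  have h2 := norm_sub_hess_le hA1 hB x (x' - x)
  have h3 := h.model_add_le hψ hx
  have h4 := neg_le_of_abs_le (abs_real_inner_le_norm
    (Matrix.toEuclideanCLM (𝕜 := ℝ) B (x' - x) - hess f x (x' - x)) (x' - x))
  rw [inner_sub_left] at h4
  have h5 := mul_le_mul_of_nonneg_right h2 (norm_nonneg (x' - x))
  unfold realObjective model at *
  linarith

/-- The length of an inexact step, for a uniformly positive matrix of the model. -/
theorem IsInexactStep.mul_norm_sub_le (hψ : IsProperClosedConvex ψ)
    (hA2 : HessianBoundedBelow f (dom ψ) μ) (hσ : 0 ≤ σ) (hx₀ : x₀ ∈ dom ψ)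
    (hB : ∀ v, ‖Matrix.toEuclideanCLM (𝕜 := ℝ) B v - hess f x₀ v‖ ≤ δ * ‖v‖)
    (hp : p ∈ subdiff ψ x) (h : IsInexactStep f ψ B σ x x' p') :
    (μ - δ) / 2 * ‖x' - x‖ ≤ ‖gradient f x + p‖ := by
  have h3 := h.model_add_le hψ hp.1
  have h4 := neg_le_of_abs_le (abs_real_inner_le_norm
    (Matrix.toEuclideanCLM (𝕜 := ℝ) B (x' - x) - hess f x₀ (x' - x)) (x' - x))
  rw [inner_sub_left] at h4
  have h5 := mul_le_mul_of_nonneg_right (hB (x' - x)) (norm_nonneg (x' - x))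
  -- Coercivity of `B` is inherited from the Hessian at `x₀`, not at `x`, so the drift does not
  -- weaken it.
  have h6 := hA2 x₀ hx₀ (x' - x)
  have h7 := subgradient_le hψ hp h.1.1
  have h8 := neg_le_of_abs_le (abs_real_inner_le_norm (gradient f x + p) (x' - x))
  rw [inner_add_left] at h8
  have h9 : 0 ≤ σ / 6 * ‖x' - x‖ ^ 3 := by positivity
  unfold realObjective model at *
  rcases (norm_nonneg (x' - x)).eq_or_lt with h0 | h0
  · rw [← h0]; simp
  · refine le_of_mul_le_mul_right ?_ h0
    linarith

end Step

end HFCNM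

namespace HFCNM

variable {n : ℕ}

/-! ### Numerical constants and the parameters σ, h and κ. -/

section Parameters

theorem two_thirds_rpow_pos : 0 < (2 / 3 : ℝ) ^ (1 / 3 : ℝ) := by positivity

theorem two_thirds_rpow_pow_three : ((2 / 3 : ℝ) ^ (1 / 3 : ℝ)) ^ 3 = 2 / 3 := by
  rw [← Real.rpow_natCast, ← Real.rpow_mul (by norm_num)]
  norm_num

/-- Gives σ ≥ 13 m 2^ℓ τ, the source of the number 13 in the progress estimates. -/
theorem le_two_thirds_rpow : 13 / 16 ≤ (2 / 3 : ℝ) ^ (1 / 3 : ℝ) := by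
  refine le_of_pow_le_pow_left₀ (n := 3) (by norm_num) two_thirds_rpow_pos.le ?_
  rw [two_thirds_rpow_pow_three]
  norm_num

theorem cConst_pow_six : cConst ^ 6 = 1 / (3 * 2 ^ 13) := by
  have h1 : ((3 : ℝ) ^ (1 / 6 : ℝ)) ^ 6 = 3 := by
    rw [← Real.rpow_natCast, ← Real.rpow_mul (by norm_num)]
    norm_num
  have h2 : ((2 : ℝ) ^ (13 / 6 : ℝ)) ^ 6 = 2 ^ 13 := by
    rw [← Real.rpow_natCast, ← Real.rpow_mul (by norm_num), ← Real.rpow_natCast]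
    norm_num
  rw [cConst, div_pow, mul_pow, h1, h2, one_pow]

/-- The factor 25 is exactly what makes the finite-difference error at most σw/40 in
`Trial.lt_of_halt`. -/
theorem cConst_sq_le : cConst ^ 2 ≤ (2 / 3 : ℝ) ^ (1 / 3 : ℝ) / 25 := by
  refine le_of_pow_le_pow_left₀ (n := 3) (by norm_num)
    (div_nonneg two_thirds_rpow_pos.le (by norm_num)) ?_
  rw [← pow_mul, div_pow, two_thirds_rpow_pow_three, cConst_pow_six]
  norm_num

variable {m : ℕ} {ε τ : ℝ}

theorem sigmaPar_pos (hm : 1 ≤ m) (hτ : 0 < τ) (ℓ : ℕ) : 0 < sigmaPar m τ ℓ := by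
  have : (0 : ℝ) < m := by exact_mod_cast hm
  have := two_thirds_rpow_pos
  unfold sigmaPar
  positivity

theorem rpow_three_halves_sq {x : ℝ} (hx : 0 ≤ x) : (x ^ (3 / 2 : ℝ)) ^ 2 = x ^ 3 := by
  rw [← Real.rpow_natCast, ← Real.rpow_mul hx, ← Real.rpow_natCast]
  norm_num

theorem hPar_pos (hn : 0 < n) (hm : 1 ≤ m) (hε : 0 < ε) (hτ : 0 < τ) (ℓ : ℕ) :
    0 < hPar n m ε τ ℓ := by
  have hσ := sigmaPar_pos hm hτ ℓ
  have : (0 : ℝ) < n := by exact_mod_cast hn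
  unfold hPar
  positivity

/-- The scaled finite-difference parameter `√n h`. -/
theorem sqrt_mul_hPar_sq (hn : 0 < n) (hm : 1 ≤ m) (hε : 0 < ε) (hτ : 0 < τ) (ℓ : ℕ) :
    (√n * hPar n m ε τ ℓ) ^ 2 = cConst ^ 2 * (m * ε / (2 ^ ℓ * τ)) := by
  have hσ := sigmaPar_pos hm hτ ℓ
  have hh := hPar_pos hn hm hε hτ ℓ
  have hn' : (0 : ℝ) < n := by exact_mod_cast hn
  have hm' : (0 : ℝ) < m := by exact_mod_cast hm
  have h3 : hPar n m ε τ ℓ ^ 3 = 3 * sigmaPar m τ ℓ ^ (3 / 2 : ℝ) * ε ^ (3 / 2 : ℝ) /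
      (2 ^ 7 * 192 * (n : ℝ) ^ (3 / 2 : ℝ) * (2 ^ ℓ * τ) ^ 3) := by
    rw [hPar, ← Real.rpow_natCast, ← Real.rpow_mul (by positivity)]
    norm_num
  have h6 : hPar n m ε τ ℓ ^ 6 = 9 * sigmaPar m τ ℓ ^ 3 * ε ^ 3 /
      ((2 ^ 7 * 192) ^ 2 * (n : ℝ) ^ 3 * (2 ^ ℓ * τ) ^ 6) := by
    rw [show 6 = 3 * 2 by norm_num, pow_mul, h3, div_pow, mul_pow, mul_pow, mul_pow, mul_pow,
      rpow_three_halves_sq hσ.le, rpow_three_halves_sq hε.le, rpow_three_halves_sq hn'.le,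
      ← pow_mul]
    norm_num
  have hs : (√(n : ℝ)) ^ 6 = (n : ℝ) ^ 3 := by
    rw [show 6 = 2 * 3 by norm_num, pow_mul, Real.sq_sqrt hn'.le]
  -- Cubing turns both sides into sixth powers, where all fractional exponents disappear.
  refine (pow_left_inj₀ (by positivity) (by positivity) (three_ne_zero)).1 ?_
  rw [← pow_mul, mul_pow, mul_pow (cConst ^ 2), ← pow_mul, cConst_pow_six, hs, h6]
  have h2 : (0 : ℝ) < 2 ^ ℓ * τ := by positivity
  unfold sigmaPar
  generalize (2 : ℝ) ^ ℓ * τ = β at h2 ⊢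
  rw [mul_pow _ (m : ℝ), mul_pow _ β, mul_pow _ ((2 / 3 : ℝ) ^ (1 / 3 : ℝ)),
    two_thirds_rpow_pow_three]
  field_simp
  norm_num

/-- With ε = σw² the progress threshold becomes polynomial in σ and w, hence usable in the scalar
inequalities. -/
theorem progress_const {σ w : ℝ} (hσ : 0 < σ) (hw : 0 < w) :
    (σ * w ^ 2) ^ (3 / 2 : ℝ) / (384 * σ ^ (1 / 2 : ℝ)) = σ * w ^ 3 / 384 := by
  have h1 : (w ^ 2) ^ (3 / 2 : ℝ) = w ^ 3 := by
    rw [← Real.rpow_natCast, ← Real.rpow_mul hw.le, ← Real.rpow_natCast]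
    norm_num
  have h2 : σ ^ (3 / 2 : ℝ) = σ * σ ^ (1 / 2 : ℝ) := by
    rw [show (3 / 2 : ℝ) = 1 + 1 / 2 by norm_num, Real.rpow_add hσ, Real.rpow_one]
  have h3 : 0 < σ ^ (1 / 2 : ℝ) := by positivity
  rw [Real.mul_rpow hσ.le (by positivity), h1, h2]
  field_simp

theorem kappa_denom_pos {L τ₀ : ℝ} (hL : 0 ≤ L) (hτ₀ : 0 < τ₀) (hm : 1 ≤ m) :
    0 < 3 * 2 ^ 6 * (2 / 3 : ℝ) ^ (1 / 3 : ℝ) * m * max τ₀ L + 8 * L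
      + cConst ^ 2 * L ^ 2 * m / τ₀ := by
  have h1 := two_thirds_rpow_pos
  have h2 : (0 : ℝ) < m := by exact_mod_cast hm
  have h3 : 0 < max τ₀ L := lt_max_of_lt_left hτ₀
  positivity

theorem kappa_pos {L μ τ₀ : ℝ} (hμ : 0 < μ) (hL : 0 ≤ L) (hτ₀ : 0 < τ₀) (hm : 1 ≤ m) :
    0 < kappa μ L τ₀ m := by
  have := kappa_denom_pos hL hτ₀ hm
  unfold kappa
  positivity

theorem kappa_mul_denom {L μ τ₀ : ℝ} (hL : 0 ≤ L) (hτ₀ : 0 < τ₀) (hm : 1 ≤ m) :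
    kappa μ L τ₀ m * (3 * 2 ^ 6 * (2 / 3 : ℝ) ^ (1 / 3 : ℝ) * m * max τ₀ L + 8 * L
      + cConst ^ 2 * L ^ 2 * m / τ₀) = μ ^ 2 / 2 := by
  have := (kappa_denom_pos hL hτ₀ hm).ne'
  unfold kappa
  rw [inv_mul_cancel_right₀ this]
  ring

end Parameters

/-! ### Scalar inequalities behind progress and quadratic decrease. -/

section Scalar

/-- The progress of one step in normalized variables. -/
theorem scaled_progress {s u d l : ℝ} (hs : 0 ≤ s) (hu : 0 ≤ u) (hd : d ≤ 1 / 40)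
    (hl : l ≤ 1 / 13) (h : 1 ≤ (l / 2 + 3 / 4) * s ^ 2 + (d + u) * s) :
    1 / 384 + 1 / 20 * s ^ 3
      ≤ (1 - l) / 6 * s ^ 3 - (d + u) * s ^ 2 / 2 + 2197 / 20 * u ^ 3 := by
  have hs2 : 0 ≤ s ^ 2 := sq_nonneg s
  have hs3 : 0 ≤ s ^ 3 := by positivity
  have hu3 : 0 ≤ u ^ 3 := by positivity
  have h1 : 2 / 13 * s ^ 3 ≤ (1 - l) / 6 * s ^ 3 :=
    mul_le_mul_of_nonneg_right (by linarith) hs3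
  have h2 : d * s ^ 2 ≤ 1 / 40 * s ^ 2 := mul_le_mul_of_nonneg_right hd hs2
  -- A Young inequality with generous constants: the drift term is traded for a small part of the
  -- cubic gain and a multiple of u³.
  have h3 : u * s ^ 2 / 2 ≤ 1 / 50 * s ^ 3 + 100 * u ^ 3 := by
    nlinarith [mul_nonneg hs (sq_nonneg (s - 25 * u)), mul_nonneg hu (sq_nonneg (s - 25 * u)),
      mul_nonneg hs (sq_nonneg (s - 12 * u)), mul_nonneg hu (sq_nonneg (s - 12 * u))]
  suffices 1 / 384 ≤ 2 / 25 * s ^ 3 - s ^ 2 / 80 + 9 * u ^ 3 by linarith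
  have h4 : l * s ^ 2 ≤ 1 / 13 * s ^ 2 := mul_le_mul_of_nonneg_right hl hs2
  have h5 : d * s ≤ 1 / 40 * s := mul_le_mul_of_nonneg_right hd hs
  -- A large new gradient forces a long step or a large drift. A long step gains enough by itself;
  -- otherwise u ≥ 1/2 and the u³ term suffices.
  rcases le_or_gt (1 / 2) s with h6 | h6
  · have h7 : (1 / 4 : ℝ) ≤ s ^ 2 := by nlinarith
    nlinarith
  · have h7 : 1 / 2 ≤ u := by
      by_contra! h8
      nlinarith
    have h8 : (1 / 2 : ℝ) ^ 3 ≤ u ^ 3 := pow_le_pow_left₀ (by norm_num) h7 3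
    nlinarith

/-- The progress of one step. -/
theorem step_progress {σ w r Δ L δ G F F' : ℝ} (hσ : 0 < σ) (hw : 0 < w) (hr : 0 ≤ r)
    (hΔ : 0 ≤ Δ) (hL : 0 ≤ L) (hδ : δ ≤ σ * w / 40) (hLσ : 13 * L ≤ σ)
    (hG : σ * w ^ 2 < G)
    (h1 : G ≤ (L / 2 + 3 * σ / 4) * r ^ 2 + (δ + L * Δ) * r)
    (h2 : F' ≤ F + (δ + L * Δ) * r ^ 2 / 2 - (σ - L) / 6 * r ^ 3) :
    F' + σ * w ^ 3 / 384 + σ / 20 * r ^ 3 ≤ F + 2197 * (L * Δ) ^ 3 / (20 * σ ^ 2) := by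
  have h := scaled_progress (s := r / w) (u := L * Δ / (σ * w)) (d := δ / (σ * w)) (l := L / σ)
    (by positivity) (by positivity) (by rw [div_le_iff₀ (by positivity)]; linarith)
    (by rw [div_le_iff₀ hσ]; linarith) ?_
  · have hk : 0 < σ * w ^ 3 := by positivity
    have h3 := mul_le_mul_of_nonneg_left h hk.le
    have e1 : σ * w ^ 3 * (1 / 384 + 1 / 20 * (r / w) ^ 3)
        = σ * w ^ 3 / 384 + σ / 20 * r ^ 3 := by field_simp
    have e2 : σ * w ^ 3 * ((1 - L / σ) / 6 * (r / w) ^ 3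
        - (δ / (σ * w) + L * Δ / (σ * w)) * (r / w) ^ 2 / 2
        + 2197 / 20 * (L * Δ / (σ * w)) ^ 3)
        = (σ - L) / 6 * r ^ 3 - (δ + L * Δ) * r ^ 2 / 2
          + 2197 * (L * Δ) ^ 3 / (20 * σ ^ 2) := by field_simp
    rw [e1, e2] at h3
    linarith
  · have e : (L / σ / 2 + 3 / 4) * (r / w) ^ 2 + (δ / (σ * w) + L * Δ / (σ * w)) * (r / w)
        = ((L / 2 + 3 * σ / 4) * r ^ 2 + (δ + L * Δ) * r) / (σ * w ^ 2) := by
      field_simp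
    rw [e, one_le_div (by positivity)]
    linarith

/-- The inductive step of `(∑ rᵢ)³ ≤ t² ∑ rᵢ³`. -/
theorem add_pow_three_le {t a b Q : ℝ} (ht : 0 ≤ t) (ha : 0 ≤ a) (hb : 0 ≤ b) (hQ : 0 ≤ Q)
    (h : a ^ 3 ≤ t ^ 2 * Q) : (a + b) ^ 3 ≤ (t + 1) ^ 2 * (Q + b ^ 3) := by
  rcases ht.eq_or_lt with rfl | ht
  · have : a = 0 := by
      refine pow_eq_zero_iff (three_ne_zero) |>.1 (le_antisymm ?_ (by positivity))
      simpa using h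
    subst this
    simpa using hQ
  · refine le_of_mul_le_mul_left ?_ (show 0 < t ^ 2 by positivity)
    -- This product equals (t+1)²(a³ + t²b³) - t²(a+b)³, the scaled gap in the extremal case Q =
    -- a³/t².
    have h1 : 0 ≤ (a - t * b) ^ 2 * ((2 * t + 1) * a + t * (t + 2) * b) := by positivity
    have h2 := mul_le_mul_of_nonneg_left h (show 0 ≤ (t + 1) ^ 2 by positivity)
    nlinarith

/-- The quadratic decrease of the composite gradient in one step. -/
theorem step_quadratic {g g' g₀ r Δ q L σ μ C A ε : ℝ} (hε : 0 < ε)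
    (hL : 0 ≤ L) (hμ : 0 < μ) (hr : 0 ≤ r) (hσ : 0 ≤ σ) (hC : 0 ≤ C) (hg : 0 ≤ g)
    (h1 : g' ≤ (L / 2 + 3 * σ / 4) * r ^ 2 + (L / 2 * q + L * Δ) * r)
    (hq : q ^ 2 ≤ C * ε) (hg' : ε < g') (hr' : 3 * μ * r ≤ 8 * g) (hΔ : Δ ≤ 2 * g₀ / μ)
    (hgg : g ≤ g₀) (hσA : 64 * σ ≤ 11 * A) (hLA : 64 * L ≤ A) :
    g' ≤ g * g₀ * (2 * (A + 8 * L + L ^ 2 * C) / μ ^ 2) := by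
  -- AM-GM for ε and CL²r²/4, whose product is at least (Lqr)²/4.
  have h2 : L * q * r ≤ ε + C * L ^ 2 * r ^ 2 / 4 := by
    have h3 : q ^ 2 * (L * r) ^ 2 ≤ C * ε * (L * r) ^ 2 :=
      mul_le_mul_of_nonneg_right hq (sq_nonneg _)
    nlinarith [sq_nonneg (ε - C * L ^ 2 * r ^ 2 / 4), sq_nonneg (L * q * r),
      abs_le_of_sq_le_sq' (a := L * q * r) (b := ε + C * L ^ 2 * r ^ 2 / 4)
      (by nlinarith [sq_nonneg (ε - C * L ^ 2 * r ^ 2 / 4)]) (by positivity)]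
  -- Half of the previous bound leaves ε/2 < g'/2, absorbed on the left; this doubles the other
  -- coefficients.
  have h4 : g' ≤ (L + 3 * σ / 2 + C * L ^ 2 / 4) * r ^ 2 + 2 * L * Δ * r := by nlinarith
  have hr'' : r ≤ 8 / 3 * (g / μ) := by
    rw [← mul_div_assoc, le_div_iff₀ hμ]; linarith
  have hg₀ : 0 ≤ g₀ := hg.trans hgg
  have h5 : r ^ 2 ≤ 64 / 9 * (g * g₀ / μ ^ 2) := by
    calc r ^ 2 ≤ (8 / 3 * (g / μ)) ^ 2 := pow_le_pow_left₀ hr hr'' 2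
      _ = 64 / 9 * (g * g / μ ^ 2) := by ring
      _ ≤ _ := by gcongr
  have h6 : Δ * r ≤ 16 / 3 * (g * g₀ / μ ^ 2) := by
    calc Δ * r ≤ 2 * g₀ / μ * (8 / 3 * (g / μ)) := by gcongr
      _ = _ := by ring
  set X := g * g₀ / μ ^ 2 with hX
  have hX0 : 0 ≤ X := by positivity
  have h7 : (L + 3 * σ / 2 + C * L ^ 2 / 4) * r ^ 2
      ≤ (L + 3 * σ / 2 + C * L ^ 2 / 4) * (64 / 9 * X) := by gcongr
  have h8 : 2 * L * (Δ * r) ≤ 2 * L * (16 / 3 * X) := by gcongr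
  have e : g * g₀ * (2 * (A + 8 * L + L ^ 2 * C) / μ ^ 2) = 2 * (A + 8 * L + L ^ 2 * C) * X := by
    rw [hX]; ring
  rw [e]
  have h9 : 0 ≤ C * L ^ 2 * X := by positivity
  have h10 : 64 * σ * X ≤ 11 * A * X := mul_le_mul_of_nonneg_right hσA hX0
  have h11 : 64 * L * X ≤ A * X := mul_le_mul_of_nonneg_right hLA hX0
  nlinarith

end Scalar

end HFCNM

namespace HFCNM

variable {n : ℕ}

/-! ### The inner loop: progress and superlinear decrease over m steps. -/

section Loop

variable {f : Vec n → ℝ} {ψ : Vec n → EReal} {L μ σ δ ε : ℝ} {m : ℕ}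
  {B : Matrix (Fin n) (Fin n) ℝ} {x₀ : Vec n}

theorem CubicLoop.mem_subdiff_and_le {t : ℕ} {x p y q : Vec n}
    (h : CubicLoop f ψ B σ m ε x₀ t x p y q Status.solution) :
    q ∈ subdiff ψ y ∧ ‖gradient f y + q‖ ≤ ε := by
  generalize hα : Status.solution = α at h
  induction h with
  | success => cases hα
  | solution t x p x' p' ht hstep hsmall => exact ⟨hstep.1, hsmall⟩
  | halt => cases hα
  | next t x p x' p' y q α ht hstep hlarge hprog hrest ih => exact ih hα

/-- One inexact step preserves the accumulated progress; `Q` stands for the sum of the cubes of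
the lengths of the previous steps. -/
theorem IsInexactStep.accumulated_progress (hf : ContDiff ℝ 2 f) (hψ : IsProperClosedConvex ψ)
    (hL : 0 ≤ L) (hA1 : HessianLipschitz f L) (hσ : 0 < σ) (hBt : B.transpose = B)
    (hB : ∀ v, ‖Matrix.toEuclideanCLM (𝕜 := ℝ) B v - hess f x₀ v‖ ≤ δ * ‖v‖)
    {w : ℝ} (hw : 0 < w) (hδ : δ ≤ σ * w / 40) (hLσ : 13 * m * L ≤ σ)
    {t : ℕ} (ht : t < m) {x p' x' : Vec n} (hx : x ∈ dom ψ) {Q : ℝ} (hQ : 0 ≤ Q)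
    (hΔ : ‖x - x₀‖ ^ 3 ≤ (t : ℝ) ^ 2 * Q)
    (hF : realObjective f ψ x + t * (σ * w ^ 3 / 384) + σ / 20 * (1 - t / m) * Q
      ≤ realObjective f ψ x₀)
    (hstep : IsInexactStep f ψ B σ x x' p') (hlarge : σ * w ^ 2 < ‖gradient f x' + p'‖) :
    ‖x' - x₀‖ ^ 3 ≤ ((t + 1 : ℕ) : ℝ) ^ 2 * (Q + ‖x' - x‖ ^ 3) ∧
    realObjective f ψ x' + ((t + 1 : ℕ) : ℝ) * (σ * w ^ 3 / 384)
        + σ / 20 * (1 - ((t + 1 : ℕ) : ℝ) / m) * (Q + ‖x' - x‖ ^ 3)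
      ≤ realObjective f ψ x₀ := by
  have hm0 : (0 : ℝ) < m := by exact_mod_cast (Nat.zero_le t).trans_lt ht
  have htm : (t : ℝ) ≤ m := by exact_mod_cast ht.le
  have hm1 : (1 : ℝ) ≤ m := by exact_mod_cast (Nat.zero_le t).trans_lt ht
  have hLσ1 : 13 * L ≤ σ := by nlinarith
  push_cast
  constructor
  · have h1 : ‖x' - x₀‖ ≤ ‖x - x₀‖ + ‖x' - x‖ := by
      rw [add_comm]; exact norm_sub_le_norm_sub_add_norm_sub _ _ _
    exact (pow_le_pow_left₀ (norm_nonneg _) h1 3).trans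
      (add_pow_three_le (Nat.cast_nonneg t) (norm_nonneg _) (norm_nonneg _) hQ hΔ)
  · have h1 := step_progress hσ hw (norm_nonneg (x' - x)) (norm_nonneg (x - x₀)) hL hδ hLσ1 hlarge
      (hstep.norm_gradient_le hf hA1 hσ.le hBt hB) (hstep.realObjective_le hf hψ hA1 hB hx)
    -- Since 2197 = 13³, the loss of a step is at most a fraction 1/m of the cubic reserve, which
    -- explains the weight 1 - t/m: it reaches zero only after m steps.
    have h2 : 2197 * (L * ‖x - x₀‖) ^ 3 / (20 * σ ^ 2) ≤ σ / 20 * (Q / m) := by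
      have h3 : (13 * m * L) ^ 3 ≤ σ ^ 3 := pow_le_pow_left₀ (by positivity) hLσ 3
      have h4 : ‖x - x₀‖ ^ 3 ≤ (m : ℝ) ^ 2 * Q :=
        hΔ.trans (mul_le_mul_of_nonneg_right (pow_le_pow_left₀ (Nat.cast_nonneg t) htm 2) hQ)
      have h5 : (13 * m * L) ^ 3 * ‖x - x₀‖ ^ 3 ≤ σ ^ 3 * ((m : ℝ) ^ 2 * Q) :=
        mul_le_mul h3 h4 (by positivity) (by positivity)
      rw [div_le_iff₀ (by positivity)]
      have e : σ / 20 * (Q / m) * (20 * σ ^ 2) = σ ^ 3 * ((m : ℝ) ^ 2 * Q) / (m : ℝ) ^ 3 := by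
        field_simp
      rw [e, le_div_iff₀ (by positivity)]
      calc _ = (13 * m * L) ^ 3 * ‖x - x₀‖ ^ 3 := by ring
        _ ≤ _ := h5
    have h6 : 0 ≤ σ / 20 * (((t : ℝ) + 1) / m) * ‖x' - x‖ ^ 3 := by positivity
    have e : σ / 20 * (1 - ((t : ℝ) + 1) / m) * (Q + ‖x' - x‖ ^ 3)
        = σ / 20 * (1 - t / m) * Q - σ / 20 * (Q / m) + σ / 20 * ‖x' - x‖ ^ 3
          - σ / 20 * (((t : ℝ) + 1) / m) * ‖x' - x‖ ^ 3 := by ring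
    rw [e]
    linarith

/-- With a large regularization parameter, the procedure does not halt. -/
theorem CubicLoop.ne_halt (hf : ContDiff ℝ 2 f) (hψ : IsProperClosedConvex ψ)
    (hL : 0 ≤ L) (hA1 : HessianLipschitz f L) (hσ : 0 < σ) (hBt : B.transpose = B)
    (hB : ∀ v, ‖Matrix.toEuclideanCLM (𝕜 := ℝ) B v - hess f x₀ v‖ ≤ δ * ‖v‖)
    {w : ℝ} (hw : 0 < w) (hε : ε = σ * w ^ 2) (hδ : δ ≤ σ * w / 40) (hLσ : 13 * m * L ≤ σ)
    (hx₀ : x₀ ∈ dom ψ) {t : ℕ} {x p y q : Vec n} {α : Status}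
    (h : CubicLoop f ψ B σ m ε x₀ t x p y q α) (ht : t ≤ m) (hx : x ∈ dom ψ) {Q : ℝ} (hQ : 0 ≤ Q)
    (hΔ : ‖x - x₀‖ ^ 3 ≤ (t : ℝ) ^ 2 * Q)
    (hF : realObjective f ψ x + t * (σ * w ^ 3 / 384) + σ / 20 * (1 - t / m) * Q
      ≤ realObjective f ψ x₀) :
    α ≠ Status.halt := by
  induction h generalizing Q with
  | success => exact fun h => by cases h
  | solution => exact fun h => by cases h
  | halt t x p x' p' htm hstep hlarge hprog =>
    intro _
    have htm' : t < m := lt_of_le_of_ne ht htm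
    obtain ⟨-, h2⟩ := hstep.accumulated_progress hf hψ hL hA1 hσ hBt hB hw hδ hLσ htm' hx hQ hΔ
      hF (hε ▸ hlarge)
    refine hprog ((sufficientProgress_iff hψ hx₀ hstep.1.1).2 ?_)
    rw [hε, progress_const hσ hw]
    have hm0 : (0 : ℝ) < m := by exact_mod_cast (Nat.zero_le t).trans_lt htm'
    have h3 : ((t + 1 : ℕ) : ℝ) / m ≤ 1 := by
      rw [div_le_one hm0]; exact_mod_cast htm'
    have h4 : 0 ≤ σ / 20 * (1 - ((t + 1 : ℕ) : ℝ) / m) * (Q + ‖x' - x‖ ^ 3) :=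
      mul_nonneg (mul_nonneg (by positivity) (by linarith)) (by positivity)
    push_cast at *
    linarith
  | next t x p x' p' y q α htm hstep hlarge hprog hrest ih =>
    have htm' : t < m := lt_of_le_of_ne ht htm
    obtain ⟨h1, h2⟩ := hstep.accumulated_progress hf hψ hL hA1 hσ hBt hB hw hδ hLσ htm' hx hQ hΔ
      hF (hε ▸ hlarge)
    exact ih htm' hstep.1.1 (by positivity) h1 h2

/-- A quadratic decrease per step yields a decrease of order `1 + m` over `m` steps. -/
theorem CubicLoop.superlinear (hψ : IsProperClosedConvex ψ) (hσ : 0 < σ) (hε : 0 < ε)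
    (hx₀ : x₀ ∈ dom ψ) {g₀ κ : ℝ} (hκ : 0 < κ) (hg₀ : 0 ≤ g₀) (hg₀κ : g₀ ≤ κ)
    (hquad : ∀ x p x' p', p ∈ subdiff ψ x → realObjective f ψ x ≤ realObjective f ψ x₀ →
      ‖gradient f x + p‖ ≤ g₀ → IsInexactStep f ψ B σ x x' p' → ε < ‖gradient f x' + p'‖ →
      ‖gradient f x' + p'‖ ≤ ‖gradient f x + p‖ * (g₀ / κ))
    {t : ℕ} {x p y q : Vec n} (h : CubicLoop f ψ B σ m ε x₀ t x p y q Status.success)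
    (hp : p ∈ subdiff ψ x) (hle : realObjective f ψ x ≤ realObjective f ψ x₀)
    (hlow : ε ≤ ‖gradient f x + p‖) (hg : ‖gradient f x + p‖ ≤ g₀ * (g₀ / κ) ^ t) :
    q ∈ subdiff ψ y ∧ ε ≤ ‖gradient f y + q‖ ∧ ‖gradient f y + q‖ ≤ g₀ * (g₀ / κ) ^ m := by
  generalize hα : Status.success = α at h
  induction h with
  | success => exact ⟨hp, hlow, hg⟩
  | solution => cases hα
  | halt => cases hα
  | next t x p x' p' y q α htm hstep hlarge hprog hrest ih =>
    have hr0 : 0 ≤ g₀ / κ := by positivity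
    have hr1 : g₀ / κ ≤ 1 := (div_le_one hκ).2 hg₀κ
    have hgle : ‖gradient f x + p‖ ≤ g₀ :=
      hg.trans (mul_le_of_le_one_right hg₀ (pow_le_one₀ hr0 hr1))
    refine ih hstep.1 ?_ hlarge.le ?_ hα
    · have h1 := (sufficientProgress_iff hψ hx₀ hstep.1.1).1 hprog
      have h2 : 0 ≤ ε ^ (3 / 2 : ℝ) / (384 * σ ^ (1 / 2 : ℝ)) * ((t : ℝ) + 1) := by positivity
      linarith
    · calc _ ≤ ‖gradient f x + p‖ * (g₀ / κ) := hquad _ _ _ _ hp hle hgle hstep hlarge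
        _ ≤ g₀ * (g₀ / κ) ^ t * (g₀ / κ) := mul_le_mul_of_nonneg_right hg hr0
        _ = _ := by ring

end Loop

/-! ### One trial with the actual parameters. -/

section Trial

variable {f : Vec n → ℝ} {ψ : Vec n → EReal} {L μ τ₀ τ ε : ℝ} {m ℓ : ℕ} {x p y q : Vec n}

theorem dim_pos_of_norm_pos {v : Vec n} (hv : 0 < ‖v‖) : 0 < n := by
  rcases Nat.eq_zero_or_pos n with rfl | h
  · rw [Subsingleton.elim v 0, norm_zero] at hv
    exact absurd hv (lt_irrefl 0)
  · exact h

theorem sigmaPar_eq (m : ℕ) (τ : ℝ) (ℓ : ℕ) :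
    sigmaPar m τ ℓ = 16 * (2 / 3 : ℝ) ^ (1 / 3 : ℝ) * m * (2 ^ ℓ * τ) := by
  unfold sigmaPar
  ring

/-- A trial with `2^ℓ τ ≥ L` does not halt. -/
theorem Trial.lt_of_halt (hf : ContDiff ℝ 2 f) (hψ : IsProperClosedConvex ψ)
    (hL : 0 ≤ L) (hA1 : HessianLipschitz f L) (hn : 0 < n) (hτ : 0 < τ) (hε : 0 < ε)
    (hm : 1 ≤ m) (hp : p ∈ subdiff ψ x) (h : Trial f ψ m ε x p τ ℓ y q Status.halt) :
    2 ^ ℓ * τ < L := by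
  by_contra! hLβ
  have hσ := sigmaPar_pos hm hτ ℓ
  have hh := hPar_pos hn hm hε hτ ℓ
  have hq := sqrt_mul_hPar_sq hn hm hε hτ ℓ
  have hσe := sigmaPar_eq m τ ℓ
  have ha := le_two_thirds_rpow
  have hc := cConst_sq_le
  have hm' : (1 : ℝ) ≤ m := by exact_mod_cast hm
  have hβ : 0 < 2 ^ ℓ * τ := by positivity
  refine CubicLoop.ne_halt (δ := L / 2 * (√n * hPar n m ε τ ℓ)) (w := √(ε / sigmaPar m τ ℓ))
    hf hψ hL hA1 hσ (fdHessian_transpose _ _ _)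
    (norm_fdHessian_sub_hess_le hf hL hA1 x hh) (by positivity) ?_ ?_ ?_ hp.1 h (Nat.zero_le m)
    hp.1 le_rfl ?_ ?_ rfl
  · rw [Real.sq_sqrt (by positivity)]
    field_simp
  · refine le_of_pow_le_pow_left₀ two_ne_zero (by positivity) ?_
    rw [mul_pow, hq, div_pow (sigmaPar m τ ℓ * _), mul_pow, Real.sq_sqrt (by positivity)]
    have e : sigmaPar m τ ℓ ^ 2 * (ε / sigmaPar m τ ℓ) / 40 ^ 2 = sigmaPar m τ ℓ * ε / 1600 := by
      field_simp
      norm_num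
    rw [e, hσe]
    generalize (2 / 3 : ℝ) ^ (1 / 3 : ℝ) = a at *
    generalize (2 : ℝ) ^ ℓ * τ = β at *
    have hL2 : L ^ 2 ≤ β ^ 2 := pow_le_pow_left₀ hL hLβ 2
    calc (L / 2) ^ 2 * (cConst ^ 2 * (m * ε / β)) = L ^ 2 * cConst ^ 2 * (m * ε / β) / 4 := by ring
      _ ≤ β ^ 2 * (a / 25) * (m * ε / β) / 4 := by gcongr
      _ = _ := by field_simp; norm_num
  · rw [hσe]
    generalize (2 / 3 : ℝ) ^ (1 / 3 : ℝ) = a at *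
    have h13 : (13 : ℝ) ≤ 16 * a := by linarith
    gcongr
  · simp
  · simp

/-- The decrease of the composite gradient over one successful iteration. -/
theorem Trial.superlinear (hf : ContDiff ℝ 2 f) (hψ : IsProperClosedConvex ψ)
    (hL : 0 ≤ L) (hA1 : HessianLipschitz f L) (hμ : 0 < μ)
    (hA2 : HessianBoundedBelow f (dom ψ) μ) (hτ₀ : 0 < τ₀) (hε : 0 < ε) (hm : 1 ≤ m)
    (hτ : τ₀ ≤ τ) (hβ : 2 ^ ℓ * τ ≤ 2 * max τ₀ L) (hp : p ∈ subdiff ψ x)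
    (hlow : ε ≤ ‖gradient f x + p‖) (hupp : ‖gradient f x + p‖ ≤ kappa μ L τ₀ m / 2)
    (h : Trial f ψ m ε x p τ ℓ y q Status.success) :
    q ∈ subdiff ψ y ∧ ε ≤ ‖gradient f y + q‖ ∧
      ‖gradient f y + q‖ ≤ ‖gradient f x + p‖ * (‖gradient f x + p‖ / kappa μ L τ₀ m) ^ m := by
  have hn : 0 < n := dim_pos_of_norm_pos (hε.trans_le hlow)
  have hτ' : 0 < τ := hτ₀.trans_le hτ
  have hκ := kappa_pos hμ hL hτ₀ hm
  have hσ := sigmaPar_pos hm hτ' ℓ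
  have hh := hPar_pos hn hm hε hτ' ℓ
  have hB := norm_fdHessian_sub_hess_le hf hL hA1 x hh
  have hm' : (1 : ℝ) ≤ m := by exact_mod_cast hm
  have ha := le_two_thirds_rpow
  have hMx : 0 < max τ₀ L := lt_max_of_lt_left hτ₀
  set C := cConst ^ 2 * m / τ₀ with hC
  have hC0 : 0 ≤ C := by positivity
  set A := 3 * 2 ^ 6 * (2 / 3 : ℝ) ^ (1 / 3 : ℝ) * m * max τ₀ L with hA
  have hA0 : 0 ≤ A := by positivity
  have hD : kappa μ L τ₀ m * (A + 8 * L + L ^ 2 * C) = μ ^ 2 / 2 := by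
    rw [← kappa_mul_denom hL hτ₀ hm, hA, hC]
    ring
  have hq : (√n * hPar n m ε τ ℓ) ^ 2 ≤ C * ε := by
    rw [sqrt_mul_hPar_sq hn hm hε hτ' ℓ, hC]
    have h2 : τ₀ ≤ 2 ^ ℓ * τ :=
      hτ.trans (le_mul_of_one_le_left hτ'.le (one_le_pow₀ one_le_two))
    calc cConst ^ 2 * (m * ε / (2 ^ ℓ * τ)) ≤ cConst ^ 2 * (m * ε / τ₀) := by gcongr
      _ = _ := by ring
  have hδ : L / 2 * (√n * hPar n m ε τ ℓ) ≤ μ / 4 := by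
    refine le_of_pow_le_pow_left₀ two_ne_zero (by positivity) ?_
    have h1 : L ^ 2 * (√n * hPar n m ε τ ℓ) ^ 2 ≤ L ^ 2 * (C * ε) := by gcongr
    have h2 : L ^ 2 * C * ε ≤ L ^ 2 * C * (kappa μ L τ₀ m / 2) := by
      gcongr; exact hlow.trans hupp
    have h3 : 0 ≤ kappa μ L τ₀ m * A := by positivity
    have h4 : 0 ≤ kappa μ L τ₀ m * L := by positivity
    nlinarith
  have hσA : 64 * sigmaPar m τ ℓ ≤ 11 * A := by
    rw [sigmaPar_eq, hA]
    have : 16 * (2 / 3 : ℝ) ^ (1 / 3 : ℝ) * m * (2 ^ ℓ * τ)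
        ≤ 16 * (2 / 3 : ℝ) ^ (1 / 3 : ℝ) * m * (2 * max τ₀ L) := by gcongr
    have h0 : 0 ≤ (2 / 3 : ℝ) ^ (1 / 3 : ℝ) * m * max τ₀ L := by positivity
    linarith
  have hLA : 64 * L ≤ A := by
    have h1 : (13 / 16 : ℝ) * 1 * L ≤ (2 / 3 : ℝ) ^ (1 / 3 : ℝ) * m * max τ₀ L := by
      gcongr; exact le_max_right _ _
    rw [hA]
    linarith
  -- It remains to prove the one-step quadratic decrease. There `hδ` turns (μ - δ)/2 into 3μ/8, and
  -- `hD` identifies the resulting factor with 1/κ.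
  refine CubicLoop.superlinear hψ hσ hε hp.1 hκ (norm_nonneg _) (by linarith) ?_ h hp le_rfl hlow
    (by simp)
  intro z s z' s' hs hz hzg hstep hlarge
  have hlen := hstep.mul_norm_sub_le hψ hA2 hσ.le hp.1 hB hs
  have hμr : μ / 4 * ‖z' - z‖ ≥ L / 2 * (√n * hPar n m ε τ ℓ) * ‖z' - z‖ := by gcongr
  have key := step_quadratic hε hL hμ (norm_nonneg (z' - z)) hσ.le hC0
    (norm_nonneg (gradient f z + s))
    (hstep.norm_gradient_le hf hA1 hσ.le (fdHessian_transpose _ _ _) hB) hq hlarge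
    (by linarith) (norm_sub_le_of_realObjective_le hf hψ hμ hA2 hp hs.1 hz) hzg hσA hLA
  refine key.trans_eq ?_
  rw [mul_assoc, ← mul_div_assoc, div_eq_mul_inv ‖gradient f x + p‖]
  congr 1
  rw [mul_div_assoc]
  congr 1
  rw [eq_comm, inv_eq_iff_eq_inv, inv_div, eq_div_iff (by positivity)]
  linarith

end Trial

end HFCNM

/-! ### Whole executions: invariant, termination and iteration count. -/

namespace HFCNM

variable {n : ℕ} {f : Vec n → ℝ} {ψ : Vec n → EReal} {L μ τ₀ ε : ℝ} {m : ℕ}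
  {x₀ p₀ : Vec n} {c : ℕ → Config n}

/-- What the convergence analysis maintains along an execution. -/
def Config.Invariant (f : Vec n → ℝ) (ψ : Vec n → EReal) (L τ₀ ε κ ρ : ℝ) (m : ℕ) :
    Config n → Prop
  | .running k ℓ x p τ => τ₀ ≤ τ ∧ 2 ^ ℓ * τ ≤ 2 * max τ₀ L ∧ p ∈ subdiff ψ x ∧
      ε ≤ ‖gradient f x + p‖ ∧ ‖gradient f x + p‖ / κ ≤ ρ ^ ((1 + m) ^ k)
  | .stopped _ x p => p ∈ subdiff ψ x ∧ ‖gradient f x + p‖ ≤ ε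

theorem Step.invariant (hf : ContDiff ℝ 2 f) (hψ : IsProperClosedConvex ψ)
    (hL : 0 ≤ L) (hA1 : HessianLipschitz f L) (hμ : 0 < μ)
    (hA2 : HessianBoundedBelow f (dom ψ) μ) (hτ₀ : 0 < τ₀) (hε : 0 < ε) (hm : 1 ≤ m)
    {ρ : ℝ} (hρ0 : 0 ≤ ρ) (hρ : ρ ≤ 1 / 2) {a b : Config n} (h : Step f ψ m ε τ₀ a b)
    (ha : a.Invariant f ψ L τ₀ ε (kappa μ L τ₀ m) ρ m) :
    b.Invariant f ψ L τ₀ ε (kappa μ L τ₀ m) ρ m := by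
  cases h with
  | halt k ℓ x p y q τ h =>
    obtain ⟨h1, h2, h3, h4, h5⟩ := ha
    have hlt := h.lt_of_halt hf hψ hL hA1 (dim_pos_of_norm_pos (hε.trans_le h4))
      (hτ₀.trans_le h1) hε hm h3
    refine ⟨h1, ?_, h3, h4, h5⟩
    -- Only trials with 2^ℓ τ < L halt, so doubling stays below 2L.
    rw [pow_succ]
    linarith [le_max_right τ₀ L]
  | success k ℓ x p y q τ h =>
    obtain ⟨h1, h2, h3, h4, h5⟩ := ha
    have hκ := kappa_pos hμ hL hτ₀ hm
    have hupp : ‖gradient f x + p‖ ≤ kappa μ L τ₀ m / 2 := by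
      have h6 : ρ ^ ((1 + m) ^ k) ≤ 1 / 2 :=
        (pow_le_of_le_one hρ0 (by linarith) (by positivity)).trans hρ
      have h7 := (div_le_iff₀ hκ).1 (h5.trans h6)
      linarith
    obtain ⟨g1, g2, g3⟩ := h.superlinear hf hψ hL hA1 hμ hA2 hτ₀ hε hm h1 h2 h3 h4 hupp
    refine ⟨le_max_left _ _, ?_, g1, g2, ?_⟩
    · have h8 : (2 : ℝ) ^ ((ℓ : ℤ) - 1) * τ ≤ max τ₀ L := by
        rw [zpow_sub_one₀ two_ne_zero, zpow_natCast]
        linarith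
      have h9 := max_le (le_max_left τ₀ L) h8
      have h10 : 0 < max τ₀ L := lt_max_of_lt_left hτ₀
      rw [pow_zero, one_mul]
      linarith
    · calc ‖gradient f y + q‖ / kappa μ L τ₀ m
          ≤ ‖gradient f x + p‖ * (‖gradient f x + p‖ / kappa μ L τ₀ m) ^ m / kappa μ L τ₀ m := by
            gcongr
        _ = (‖gradient f x + p‖ / kappa μ L τ₀ m) ^ (1 + m) := by ring
        _ ≤ (ρ ^ ((1 + m) ^ k)) ^ (1 + m) := by gcongr
        _ = _ := by rw [← pow_mul, ← pow_succ]
  | solution k ℓ x p y q τ h => exact CubicLoop.mem_subdiff_and_le h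

theorem IsExecution.invariant (hf : ContDiff ℝ 2 f) (hψ : IsProperClosedConvex ψ)
    (hL : 0 ≤ L) (hA1 : HessianLipschitz f L) (hμ : 0 < μ)
    (hA2 : HessianBoundedBelow f (dom ψ) μ) (hτ₀ : 0 < τ₀) (hε : 0 < ε) (hm : 1 ≤ m)
    (hp₀ : p₀ ∈ subdiff ψ x₀) (hlow : ε ≤ ‖gradient f x₀ + p₀‖)
    (hupp : ‖gradient f x₀ + p₀‖ ≤ kappa μ L τ₀ m / 2)
    (hc : IsExecution f ψ m ε τ₀ x₀ p₀ c) (i : ℕ) :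
    (c i).Invariant f ψ L τ₀ ε (kappa μ L τ₀ m) (‖gradient f x₀ + p₀‖ / kappa μ L τ₀ m) m := by
  have hκ := kappa_pos hμ hL hτ₀ hm
  induction i with
  | zero =>
    rw [hc.init]
    refine ⟨le_rfl, ?_, hp₀, hlow, by simp⟩
    linarith [le_max_left τ₀ L, pow_zero (2 : ℝ), hτ₀.trans_le (le_max_left τ₀ L)]
  | succ i ih =>
    rcases hc.step i with h | ⟨-, h⟩
    · refine h.invariant hf hψ hL hA1 hμ hA2 hτ₀ hε hm (by positivity) ?_ ih
      rw [div_le_iff₀ hκ]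
      linarith
    · rwa [h]

/-- The iterates are visited in their order, without gaps. -/
theorem IsExecution.exists_running (hc : IsExecution f ψ m ε τ₀ x₀ p₀ c) :
    ∀ (i k : ℕ) (x p : Vec n), (c i).IsIterate k x p → ∀ k' < k,
      ∃ (j ℓ : ℕ) (x' p' : Vec n) (τ : ℝ), c j = Config.running k' ℓ x' p' τ := by
  intro i
  induction i with
  | zero =>
    intro k x p hk k' hk'
    rw [hc.init] at hk
    rcases hk with ⟨ℓ, τ, h⟩ | h <;> cases h
    exact absurd hk' (Nat.not_lt_zero _)
  | succ i ih =>
    intro k x p hk k' hk'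
    rcases hc.step i with h | ⟨-, h⟩
    · generalize ha : c i = a at h
      generalize hb : c (i + 1) = b at h hk
      cases h with
      | halt k₁ ℓ x₁ p₁ y q τ h =>
        rcases hk with ⟨ℓ', τ', h'⟩ | h' <;> cases h'
        exact ih k _ _ (Or.inl ⟨ℓ, _, ha⟩) k' hk'
      | success k₁ ℓ x₁ p₁ y q τ h =>
        rcases hk with ⟨ℓ', τ', h'⟩ | h' <;> cases h'
        rcases (Nat.lt_succ_iff.1 hk').eq_or_lt with rfl | hlt
        · exact ⟨i, _, _, _, _, ha⟩
        · exact ih k₁ _ _ (Or.inl ⟨ℓ, _, ha⟩) k' hlt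
      | solution k₁ ℓ x₁ p₁ y q τ h =>
        rcases hk with ⟨ℓ', τ', h'⟩ | h' <;> cases h'
        rcases (Nat.lt_succ_iff.1 hk').eq_or_lt with rfl | hlt
        · exact ⟨i, _, _, _, _, ha⟩
        · exact ih k₁ _ _ (Or.inl ⟨ℓ, _, ha⟩) k' hlt
    · rw [h] at hk
      exact ih k x p hk k' hk'

/-- An execution that keeps running visits arbitrarily large iteration indices. -/
theorem IsExecution.exists_running_ge (hτ₀ : 0 < τ₀) {κ ρ : ℝ}
    (hc : IsExecution f ψ m ε τ₀ x₀ p₀ c) (hinv : ∀ i, (c i).Invariant f ψ L τ₀ ε κ ρ m)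
    (hrun : ∀ (i k : ℕ) (x p : Vec n), c i ≠ Config.stopped k x p) (K : ℕ) :
    ∃ (i k ℓ : ℕ) (x p : Vec n) (τ : ℝ), K ≤ k ∧ c i = Config.running k ℓ x p τ := by
  induction K with
  | zero => exact ⟨0, 0, 0, x₀, p₀, τ₀, le_rfl, hc.init⟩
  | succ K ih =>
    obtain ⟨i, k, ℓ, x, p, τ, hK, hi⟩ := ih
    by_contra! hno
    -- If the index never grows and the method never stops, every transition is a halt, and 2^ℓ τ
    -- outgrows its invariant bound.
    have hall : ∀ j, c (i + j) = Config.running k (ℓ + j) x p τ := by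
      intro j
      induction j with
      | zero => exact hi
      | succ j ihj =>
        rcases hc.step (i + j) with h | ⟨⟨_, _, _, h⟩, -⟩
        · rw [ihj] at h
          generalize hb : c (i + j + 1) = b at h
          cases h with
          | halt => rfl
          | success => exact absurd hb (hno _ _ _ _ _ _ (Nat.succ_le_succ hK))
          | solution => exact absurd hb (hrun _ _ _ _)
        · exact absurd h (hrun _ _ _ _)
    obtain ⟨N, hN⟩ := pow_unbounded_of_one_lt (2 * max τ₀ L / τ₀) one_lt_two
    have h1 := hinv (i + N)
    rw [hall N] at h1
    obtain ⟨h1, h2, -⟩ := h1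
    rw [div_lt_iff₀ hτ₀] at hN
    have h3 : (2 : ℝ) ^ N * τ₀ ≤ 2 ^ (ℓ + N) * τ := by
      gcongr
      · exact one_le_two
      · exact Nat.le_add_left _ _
    linarith

/-- Every execution stops. -/
theorem IsExecution.exists_stopped (hτ₀ : 0 < τ₀) (hε : 0 < ε) {κ ρ : ℝ} (hκ : 0 < κ)
    (hρ0 : 0 ≤ ρ) (hρ : ρ ≤ 1 / 2) (hm : 1 ≤ m)
    (hc : IsExecution f ψ m ε τ₀ x₀ p₀ c) (hinv : ∀ i, (c i).Invariant f ψ L τ₀ ε κ ρ m) :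
    ∃ (i k : ℕ) (x p : Vec n), c i = Config.stopped k x p := by
  by_contra! hrun
  obtain ⟨N, hN⟩ := exists_pow_lt_of_lt_one (show 0 < ε / κ by positivity)
    (show (1 / 2 : ℝ) < 1 by norm_num)
  obtain ⟨i, k, ℓ, x, p, τ, hk, hi⟩ := hc.exists_running_ge hτ₀ hinv hrun N
  have h := hinv i
  rw [hi] at h
  obtain ⟨-, -, -, h4, h5⟩ := h
  have h6 : N ≤ (1 + m) ^ k := hk.trans (Nat.lt_pow_self (by lia)).le
  have h7 : ρ ^ ((1 + m) ^ k) ≤ (1 / 2) ^ N :=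
    (pow_le_pow_left₀ hρ0 hρ _).trans (pow_le_pow_of_le_one (by norm_num) (by norm_num) h6)
  have h8 : ε / κ ≤ ‖gradient f x + p‖ / κ := by gcongr
  linarith

theorem half_pow_bound_of_le_quarter {ρ : ℝ} (hρ0 : 0 ≤ ρ) (hρ : ρ ≤ 1 / 4) {N : ℕ}
    (hN : 1 ≤ N) : ρ ^ N ≤ (1 / 2) ^ (N + 1) := by
  calc ρ ^ N ≤ ((1 / 2 : ℝ) ^ 2) ^ N := pow_le_pow_left₀ hρ0 (by linarith) _
    _ = (1 / 2) ^ (2 * N) := (pow_mul _ _ _).symm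
    _ ≤ _ := pow_le_pow_of_le_one (by norm_num) (by norm_num) (by lia)

/-- The iteration count implied by the superlinear decrease. -/
theorem le_logb_logb {ε κ : ℝ} {m k : ℕ} (hε : 0 < ε) (hκ : 0 < κ) (hm : 1 ≤ m)
    (h : ε / κ ≤ (1 / 2) ^ ((1 + m) ^ k)) :
    (k : ℝ) ≤ 1 / Real.logb 2 (1 + (m : ℝ)) * Real.logb 2 (Real.logb 2 (κ / ε)) := by
  have hm' : (1 : ℝ) ≤ m := by exact_mod_cast hm
  have hlog : 0 < Real.logb 2 (1 + (m : ℝ)) := Real.logb_pos one_lt_two (by linarith)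
  have h1 : (2 : ℝ) ^ ((1 + m) ^ k) ≤ κ / ε := by
    rw [le_div_iff₀ hε]
    rw [one_div, inv_pow, div_le_iff₀ hκ] at h
    calc (2 : ℝ) ^ ((1 + m) ^ k) * ε
        ≤ 2 ^ ((1 + m) ^ k) * ((2 ^ ((1 + m) ^ k))⁻¹ * κ) := by gcongr
      _ = κ := mul_inv_cancel_left₀ (by positivity) _
  have h2 : (1 + (m : ℝ)) ^ k ≤ Real.logb 2 (κ / ε) := by
    rw [Real.le_logb_iff_rpow_le one_lt_two (by positivity)]
    exact_mod_cast h1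
  have h3 : (k : ℝ) * Real.logb 2 (1 + m) ≤ Real.logb 2 (Real.logb 2 (κ / ε)) := by
    rw [← Real.logb_pow]
    exact Real.logb_le_logb_of_le one_lt_two (by positivity) h2
  rw [one_div, inv_mul_eq_div, le_div_iff₀ hlog]
  exact h3

end HFCNM

theorem mainTheorem8 (n : ℕ) (f : HFCNM.Vec n → ℝ) (ψ : HFCNM.Vec n → EReal)
    (L μ τ₀ ε : ℝ) (m : ℕ)
    (hf : ContDiff ℝ 2 f) (hψ : HFCNM.IsProperClosedConvex ψ)
    (hL : 0 ≤ L) (hA1 : HFCNM.HessianLipschitz f L)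
    (hμ : 0 < μ) (hA2 : HFCNM.HessianBoundedBelow f (HFCNM.dom ψ) μ)
    (hτ₀ : 0 < τ₀) (hε : 0 < ε) (hm : 1 ≤ m)
    (x₀ p₀ : HFCNM.Vec n) (hp₀ : p₀ ∈ HFCNM.subdiff ψ x₀)
    (hlow : ε ≤ ‖gradient f x₀ + p₀‖)
    (hupp : ‖gradient f x₀ + p₀‖ ≤ HFCNM.kappa μ L τ₀ m / 2)
    (c : ℕ → HFCNM.Config n) (hc : HFCNM.IsExecution f ψ m ε τ₀ x₀ p₀ c) :
    ∃ T : ℕ, IsLeast (HFCNM.solvedIndices f ψ ε c) T ∧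
      (T : ℝ) ≤ 1 / Real.logb 2 (1 + (m : ℝ)) *
          Real.logb 2 (Real.logb 2 (HFCNM.kappa μ L τ₀ m / ε)) + 1 ∧
      (∀ (i k : ℕ) (x p : HFCNM.Vec n), (c i).IsIterate k x p → k < T →
        ‖gradient f x + p‖ / HFCNM.kappa μ L τ₀ m ≤ (1 / 2 : ℝ) ^ ((1 + m) ^ k)) ∧
      (‖gradient f x₀ + p₀‖ ≤ HFCNM.kappa μ L τ₀ m / 4 →
        ∀ (i k : ℕ) (x p : HFCNM.Vec n), (c i).IsIterate k x p → k < T →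
          ‖gradient f x + p‖ / HFCNM.kappa μ L τ₀ m ≤ (1 / 2 : ℝ) ^ ((1 + m) ^ k + 1)) := by
  have hκ := HFCNM.kappa_pos hμ hL hτ₀ hm
  have hinv := hc.invariant hf hψ hL hA1 hμ hA2 hτ₀ hε hm hp₀ hlow hupp
  have hρ0 : 0 ≤ ‖gradient f x₀ + p₀‖ / HFCNM.kappa μ L τ₀ m := by positivity
  have hρ : ‖gradient f x₀ + p₀‖ / HFCNM.kappa μ L τ₀ m ≤ 1 / 2 := by
    rw [div_le_iff₀ hκ]
    linarith
  have hne : (HFCNM.solvedIndices f ψ ε c).Nonempty := by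
    obtain ⟨i, k, x, p, h⟩ := hc.exists_stopped hτ₀ hε hκ hρ0 hρ hm hinv
    have h1 := hinv i
    rw [h] at h1
    exact ⟨k, i, x, p, Or.inr h, p, h1.1, h1.2⟩
  have hleast : IsLeast (HFCNM.solvedIndices f ψ ε c) (sInf (HFCNM.solvedIndices f ψ ε c)) :=
    ⟨Nat.sInf_mem hne, fun k hk => Nat.sInf_le hk⟩
  -- The invariant is used with ρ = ‖F'(x₀)‖/κ, so the cases 1/2 and 1/4 come from the same decay.
  generalize sInf (HFCNM.solvedIndices f ψ ε c) = T at hleast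
  have hbound : ∀ (i k : ℕ) (x p : HFCNM.Vec n), (c i).IsIterate k x p → k < T →
      ‖gradient f x + p‖ / HFCNM.kappa μ L τ₀ m
        ≤ (‖gradient f x₀ + p₀‖ / HFCNM.kappa μ L τ₀ m) ^ ((1 + m) ^ k) := by
    intro i k x p hi hk
    have h1 := hinv i
    have hit := hi
    rcases hi with ⟨ℓ, τ, h⟩ | h <;> rw [h] at h1
    · exact h1.2.2.2.2
    -- The index at which the method stops is itself solved, hence not below `T`.
    · exact absurd (hleast.2 ⟨i, x, p, hit, p, h1.1, h1.2⟩) (not_le.2 hk)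
  refine ⟨T, hleast, ?_, fun i k x p hi hk => (hbound i k x p hi hk).trans
    (pow_le_pow_left₀ hρ0 hρ _), fun h4 i k x p hi hk => (hbound i k x p hi hk).trans
    (HFCNM.half_pow_bound_of_le_quarter hρ0 ?_ (Nat.one_le_pow _ _ (by lia)))⟩
  · cases T with
    | zero =>
      -- For T = 0 it is still needed that the double logarithm is nonnegative, which is the case k
      -- = 0 with ε ≤ κ/2.
      have h := HFCNM.le_logb_logb (k := 0) hε hκ hm (by
        rw [pow_zero, pow_one, div_le_iff₀ hκ]
        linarith)
      push_cast at h ⊢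
      linarith
    | succ k =>
      obtain ⟨i, x, p, hi, -⟩ := hleast.1
      -- At index T - 1 the method was still running, so the gradient norm there is at least ε; this
      -- is the origin of the final +1.
      obtain ⟨j, ℓ, x', p', τ, hj⟩ := hc.exists_running i (k + 1) x p hi k (Nat.lt_succ_self k)
      have h1 := hinv j
      rw [hj] at h1
      obtain ⟨-, -, -, h4, h5⟩ := h1
      have h6 : ε / HFCNM.kappa μ L τ₀ m ≤ ‖gradient f x' + p'‖ / HFCNM.kappa μ L τ₀ m := by
        gcongr
      have h7 := HFCNM.le_logb_logb hε hκ hm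
        (h6.trans (h5.trans (pow_le_pow_left₀ hρ0 hρ ((1 + m) ^ k))))
      push_cast
      linarith
  · rw [div_le_iff₀ hκ]
    linarith
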